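/- Let $\mathscr{H}^+$ be the ${}^+$stable limit DAHA: the $\mathbb{Q}(t,q)$-algebra generated by $T_i, X_i, Y_i$ ($i\ge 1$) with relations $T_iT_j=T_jT_i$ for $|i-j|>1$, $T_iT_{i+1}T_i=T_{i+1}T_iT_{i+1}$, $(T_i-1)(T_i+t)=0$; $tT_i^{-1}X_iT_i^{-1}=X_{i+1}$, $T_iX_j=X_jT_i$ for $j\ne i,i+1$, $X_iX_j=X_jX_i$; $t^{-1}T_iY_iT_i=Y_{i+1}$, $T_iY_j=Y_jT_i$ for $j\neq i,i+1$, $Y_iY_j=Y_jY_i$; and $Y_1T_1X_1=X_2Y_1T_1$. Let $\mathscr{P}_k^+=\mathbb{Q}(t,q)[x_1,\dots,x_k]$, and let $\mathscr{P}_\infty^+=\varprojlim\mathscr{P}_k^+$ be the inverse limit with respect to the maps $\mathscr{P}_{k}^+\to\mathscr{P}_{k-1}^+$, $x_k\mapsto 0$, taken either in the category of rings or in the category of graded rings (elements of bounded degree), with projections $\Pi_k:\mathscr{P}_\infty^+\to\mathscr{P}_k^+$. On $\mathscr{P}_k^+$ consider the operators $$T_if=s_if+(1-t)x_i\frac{f-s_if}{x_i-x_{i+1}}\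 (1\le i<k),\qquad \varpi_kf=\mathrm{pr}_1 f(x_2,\dots,x_k,qx_1),$$ where $s_i$ exchanges $x_i$ and $x_{i+1}$, and $\mathrm{pr}_1$ is the linear projection that fixes the monomials divisible by $x_1$ and kills the others, and the deformed Cherednik operators $$\widetilde Y^{(k)}_1=t^k\varpi_kT_{k-1}^{-1}\cdots T_1^{-1},\qquad \widetilde Y^{(k)}_{i+1}=t^{-1}T_i\widetilde Y^{(k)}_iT_i .$$ The operators $T_i$ and multiplication by $x_i$ are compatible with the inverse system and induce operators $\mathscr{T}_i,\mathscr{X}_i$ on $\mathscr{P}^+_\infty$. Let $\mathscr{P}(n)^+=\{F\in\mathscr{P}_\infty^+ : \mathscr{T}_iF=F \text{ for all } i>n\}$, and let $\mathscr{P}_{\rm as}^+=\bigcup_{n\ge0}\mathscr{P}(n)^+$ be the almost symmetric module. Scalars $a_k\in\mathbb{Q}(t,q)$ converge to $a$ if the order of vanishing of $a_k-a$ at $t=0$ tends to $+\infty$. A sequence $f_k\in\mathscr{P}_k^+$ (defined for large $k$) converges to $F\in\mathscr{P}_\infty^+$ if there are $h\in\mathscr{P}_\infty^+$, finitely many $g_1,\dots,g_N\in\mathscr{P}_{\rm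 as}^+$ and scalars $a_{j,k}\to a_j$ with $f_k=\Pi_kh+\sum_j a_{j,k}\Pi_kg_j$ for all large $k$ and $F=h+\sum_ja_jg_j$. Theorem. For each of the two versions of $\mathscr{P}_\infty^+$, there is one and only one $\mathscr{H}^+$-module structure on $\mathscr{P}_{\rm as}^+$ in which, for all $i\ge1$ and $F\in\mathscr{P}_{\rm as}^+$, $T_i$ and $X_i$ act as $\mathscr{T}_i$ and $\mathscr{X}_i$, and $Y_i$ acts as the limit operator $\mathscr{Y}_i F=\lim_k\widetilde Y_i^{(k)}\Pi_kF$ (this limit exists and lies in $\mathscr{P}_{\rm as}^+$). In other words, the limit operators $\mathscr{T}_i,\mathscr{X}_i,\mathscr{Y}_i$ are well-defined linear operators on $\mathscr{P}_{\rm as}^+$ that satisfy all the defining relations of $\mathscr{H}^+$; in particular the $\mathscr{Y}_i$ commute. -/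

import Mathlib

open Filter

noncomputable section

namespace StableDAHA

/-! ### The field `ℚ(t, q)` and the order of vanishing at `t = 0` -/

/-- The polynomial ring `ℚ[t, q]`. -/
abbrev Pol : Type := MvPolynomial (Fin 2) ℚ

/-- The field `ℚ(t, q)`. -/
abbrev K : Type := FractionRing Pol

/-- The parameter `t`. -/
def t : K := algebraMap Pol K (MvPolynomial.X 0)

/-- The parameter `q`. -/
def q : K := algebraMap Pol K (MvPolynomial.X 1)

/-- `ord a ≥ M`: writing `a = A / B` with `A, B ∈ ℚ[t, q]`, the order of vanishing of `A` at
`t = 0` minus that of `B` is at least `M` (the order of vanishing of `0` is `⊤`). -/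
def OrdGE (M : ℕ) (a : K) : Prop :=
  ∃ A B : Pol, B ≠ 0 ∧ a = algebraMap Pol K A / algebraMap Pol K B ∧
    (M : ℕ∞) + emultiplicity (MvPolynomial.X 0) B ≤ emultiplicity (MvPolynomial.X 0) A

/-- `lim a_n = b` in `ℚ(t, q)`, that is, `ord (a_n - b) → +∞`. -/
def ScalarTendsTo (a : ℕ → K) (b : K) : Prop :=
  ∀ M : ℕ, ∀ᶠ n in atTop, OrdGE M (a n - b)

/-! ### Polynomials

Everything finite takes place inside `R = K[x₁, x₂, …]`. Indices start at `0`: the variable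
`X i` is `x_{i+1}`, and all operators indexed by `i : ℕ` below are the ones usually indexed by
`i + 1`. -/

/-- The polynomial ring `K[x₁, x₂, …]`; `X i` stands for `x_{i+1}`. -/
abbrev R : Type := MvPolynomial ℕ K

/-- The variable `x_{i+1}`. -/
def x (i : ℕ) : R := MvPolynomial.X i

/-- `𝒫ₖ⁺ = K[x₁, …, xₖ]`. -/
def P (k : ℕ) : Subalgebra K R := MvPolynomial.supported K (Set.Iio k)

/-- The substitution `x_j = 0` for all `j > k`. Its restriction `𝒫⁺_{k+1} → 𝒫⁺_k` is the
structure map of the inverse system (it kills `x_{k+1}` and fixes `x₁, …, xₖ`). -/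
def proj (k : ℕ) : R →ₐ[K] R := MvPolynomial.aeval fun j => if j < k then x j else 0

/-- The transposition of `x_{i+1}` and `x_{i+2}`. -/
def s (i : ℕ) : R →ₐ[K] R := MvPolynomial.rename (Equiv.swap i (i + 1))

theorem x_sub_ne_zero (i : ℕ) : x i - x (i + 1) ≠ 0 := by
  rw [sub_ne_zero]
  intro h
  have := MvPolynomial.X_injective h
  omega

theorem s_x (i j : ℕ) : s i (x j) = x (Equiv.swap i (i + 1) j) := by
  simp [s, x]

theorem s_s (i : ℕ) (f : R) : s i (s i f) = f := by
  simp only [s, MvPolynomial.rename_rename]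
  have : (⇑(Equiv.swap i (i + 1)) ∘ ⇑(Equiv.swap i (i + 1))) = id := by
    ext j; simp
  rw [this, MvPolynomial.rename_id, AlgHom.id_apply]

theorem dvd_sub_s (i : ℕ) (f : R) : x i - x (i + 1) ∣ f - s i f := by
  induction f using MvPolynomial.induction_on with
  | C a => simp [s]
  | add f g hf hg =>
    have : f + g - s i (f + g) = (f - s i f) + (g - s i g) := by rw [map_add]; ring
    rw [this]; exact dvd_add hf hg
  | mul_X f j hf =>
    change _ ∣ f * x j - s i (f * x j)
    have : f * x j - s i (f * x j) = (f - s i f) * x j + s i f * (x j - s i (x j)) := by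
      rw [map_mul]; ring
    rw [this]
    refine dvd_add (dvd_mul_of_dvd_left hf _) (dvd_mul_of_dvd_right ?_ _)
    rw [s_x]
    by_cases h1 : j = i
    · subst h1; simp
    · by_cases h2 : j = i + 1
      · subst h2
        simp only [Equiv.swap_apply_right]
        exact ⟨-1, by ring⟩
      · rw [Equiv.swap_apply_of_ne_of_ne h1 h2]; simp

/-- The divided difference `(f - s_i f) / (x_i - x_{i+1})`. -/
def dd (i : ℕ) (f : R) : R := (dvd_sub_s i f).choose

theorem dd_spec (i : ℕ) (f : R) : f - s i f = (x i - x (i + 1)) * dd i f :=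
  (dvd_sub_s i f).choose_spec

theorem dd_unique {i : ℕ} {f g : R} (h : f - s i f = (x i - x (i + 1)) * g) : dd i f = g :=
  mul_left_cancel₀ (x_sub_ne_zero i) ((dd_spec i f).symm.trans h)

/-- The Demazure–Lusztig operator
`T_i f = s_i f + (1 - t) x_i (f - s_i f) / (x_i - x_{i+1})`. -/
def T (i : ℕ) : R →ₗ[K] R where
  toFun f := s i f + (1 - t) • (x i * dd i f)
  map_add' f g := by
    have : dd i (f + g) = dd i f + dd i g := dd_unique (by
      rw [mul_add, ← dd_spec, ← dd_spec, map_add]; ring)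
    rw [this, map_add, mul_add, smul_add]; abel
  map_smul' c f := by
    have : dd i (c • f) = c • dd i f := dd_unique (by
      rw [mul_smul_comm, ← dd_spec, map_smul, smul_sub])
    rw [this, map_smul, RingHom.id_apply, smul_add, mul_smul_comm, smul_comm]

/-- The inverse of `T_i`, see `T_Tinv` and `Tinv_T`. -/
def Tinv (i : ℕ) : R →ₗ[K] R := t⁻¹ • (T i + (t - 1) • LinearMap.id)

theorem t_ne_zero : t ≠ 0 := by
  unfold t
  rw [Ne, FaithfulSMul.algebraMap_eq_zero_iff]
  exact MvPolynomial.X_ne_zero 0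

theorem T_T (i : ℕ) (f : R) : T i (T i f) = (1 - t) • T i f + t • f := by
  set g := dd i f with hg
  have hf : f = s i f + (x i - x (i + 1)) * g := by rw [hg, ← dd_spec]; ring
  have hD : s i (x i - x (i + 1)) = -(x i - x (i + 1)) := by
    rw [map_sub, s_x, s_x, Equiv.swap_apply_left, Equiv.swap_apply_right]; ring
  have hsg : s i g = g := by
    have h1 := congrArg (s i) (dd_spec i f)
    rw [map_sub, s_s, map_mul, hD, ← hg] at h1
    have h2 : (x i - x (i + 1)) * s i g = (x i - x (i + 1)) * g := by
      rw [hg, ← dd_spec, ← hg]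
      linear_combination h1
    exact mul_left_cancel₀ (x_sub_ne_zero i) h2
  have hT : T i f = s i f + (1 - t) • (x i * g) := rfl
  have hsT : s i (T i f) = f + (1 - t) • (x (i + 1) * g) := by
    rw [hT, map_add, s_s, map_smul, map_mul, hsg, s_x, Equiv.swap_apply_left]
  have hdT : dd i (T i f) = -(t • g) := dd_unique (by
    rw [hsT, hT]
    nth_rewrite 2 [hf]
    simp only [MvPolynomial.smul_eq_C_mul, map_sub, map_one]
    ring)
  have : T i (T i f) = s i (T i f) + (1 - t) • (x i * dd i (T i f)) := rfl
  rw [this, hdT, hsT, hT]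
  simp only [MvPolynomial.smul_eq_C_mul, map_sub, map_one]
  linear_combination (1 - MvPolynomial.C t) * hf

theorem T_Tinv (i : ℕ) (f : R) : T i (Tinv i f) = f := by
  simp only [Tinv, LinearMap.smul_apply, LinearMap.add_apply, LinearMap.id_apply, map_smul,
    map_add, T_T]
  rw [show (1 - t) • T i f + t • f + (t - 1) • T i f = t • f by
    rw [add_right_comm, ← add_smul]; simp, smul_smul,
    inv_mul_cancel₀ t_ne_zero, one_smul]

theorem Tinv_T (i : ℕ) (f : R) : Tinv i (T i f) = f := by
  simp only [Tinv, LinearMap.smul_apply, LinearMap.add_apply, LinearMap.id_apply, T_T]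
  rw [show (1 - t) • T i f + t • f + (t - 1) • T i f = t • f by
    rw [add_right_comm, ← add_smul]; simp, smul_smul,
    inv_mul_cancel₀ t_ne_zero, one_smul]

/-- `T_n⁻¹ ⋯ T_2⁻¹ T_1⁻¹` (usual numbering; `T_1⁻¹` is applied first). -/
def TinvChain : ℕ → (R →ₗ[K] R)
  | 0 => LinearMap.id
  | n + 1 => Tinv n ∘ₗ TinvChain n

/-- `pr₁`: the projection onto `x₁ R` that kills the monomials not divisible by `x₁`. -/
def pr1 : R →ₗ[K] R :=
  LinearMap.id - (MvPolynomial.aeval fun j => if j = 0 then (0 : R) else x j).toLinearMap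

/-- `f(x₁, …, xₖ) ↦ f(x₂, …, xₖ, q x₁)` on `𝒫ₖ⁺` (the other variables do not occur in `𝒫ₖ⁺`
and are left alone). -/
def cyc (k : ℕ) : R →ₐ[K] R :=
  MvPolynomial.aeval fun j =>
    if j + 1 < k then x (j + 1) else if j + 1 = k then q • x 0 else x j

/-- `ϖₖ f = pr₁ f(x₂, …, xₖ, q x₁)`. -/
def varpi (k : ℕ) : R →ₗ[K] R := pr1 ∘ₗ (cyc k).toLinearMap

/-- The deformed Cherednik operators on `𝒫ₖ⁺`: in the usual numbering
`Ỹ₁ = tᵏ ϖₖ T_{k-1}⁻¹ ⋯ T_1⁻¹` and `Ỹ_{i+1} = t⁻¹ T_i Ỹ_i T_i`. So `Ytilde k i` is `Ỹ_{i+1}⁽ᵏ⁾`,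
an operator on `𝒫ₖ⁺` for `i + 1 ≤ k`. -/
def Ytilde (k : ℕ) : ℕ → (R →ₗ[K] R)
  | 0 => t ^ k • (varpi k ∘ₗ TinvChain (k - 1))
  | i + 1 => t⁻¹ • (T i ∘ₗ Ytilde k i ∘ₗ T i)

/-! ### The inverse limit and the almost symmetric module -/

/-- The inverse limit `𝒫_∞⁺` of the rings `𝒫ₖ⁺`; the projection `Πₖ` is `F ↦ F k`. -/
def PInf : Submodule K (ℕ → R) where
  carrier := {F | ∀ k, F k ∈ P k ∧ proj k (F (k + 1)) = F k}
  add_mem' ha hb k := ⟨add_mem (ha k).1 (hb k).1, by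
    rw [Pi.add_apply, map_add, (ha k).2, (hb k).2, Pi.add_apply]⟩
  zero_mem' k := ⟨zero_mem _, by simp⟩
  smul_mem' c _ ha k := ⟨(P k).smul_mem (ha k).1 c, by
    rw [Pi.smul_apply, map_smul, (ha k).2, Pi.smul_apply]⟩

/-- The inverse limit of the `𝒫ₖ⁺` in the category of graded rings: the elements of bounded
degree of `PInf`. -/
def PInfGr : Submodule K (ℕ → R) where
  carrier := {F | F ∈ PInf ∧ ∃ d, ∀ k, (F k).totalDegree ≤ d}
  add_mem' := by
    rintro F G ⟨hF, d, hd⟩ ⟨hG, e, he⟩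
    exact ⟨add_mem hF hG, max d e, fun k =>
      (MvPolynomial.totalDegree_add _ _).trans (max_le_max (hd k) (he k))⟩
  zero_mem' := ⟨zero_mem _, 0, fun k => by simp⟩
  smul_mem' := by
    rintro c F ⟨hF, d, hd⟩
    exact ⟨PInf.smul_mem c hF, d, fun k => (MvPolynomial.totalDegree_smul_le c (F k)).trans (hd k)⟩

/-- The limit operator `𝒯_i`. The operators `T_i` on `𝒫_m⁺`, which exist once both variables
exchanged by `s_i` lie in `𝒫_m⁺`, are compatible with the inverse system and induce `𝒯_i` on the
inverse limit: `Πₖ 𝒯_i F` is the image in `𝒫ₖ⁺` of `T_i Π_m F` for `m` large enough. -/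
def limT (i : ℕ) : (ℕ → R) →ₗ[K] (ℕ → R) where
  toFun F k := proj k (T i (F (max k (i + 2))))
  map_add' F G := by ext1 k; simp
  map_smul' c F := by ext1 k; simp

/-- The limit operator `𝒳_i`: multiplication by `x_i` in the inverse limit. -/
def limX (i : ℕ) : (ℕ → R) →ₗ[K] (ℕ → R) where
  toFun F k := proj k (x i) * F k
  map_add' F G := by ext1 k; simp [mul_add]
  map_smul' c F := by ext1 k; simp

/-- `𝒫(n)⁺`: the elements fixed by `𝒯_i` for all `i > n` (usual numbering). Here `L` is the
inverse limit in use, `PInf` or `PInfGr`. -/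
def PSym (L : Submodule K (ℕ → R)) (n : ℕ) : Submodule K (ℕ → R) where
  carrier := {F | F ∈ L ∧ ∀ i, n ≤ i → limT i F = F}
  add_mem' ha hb := ⟨add_mem ha.1 hb.1, fun i hi => by rw [map_add, ha.2 i hi, hb.2 i hi]⟩
  zero_mem' := ⟨zero_mem _, fun i _ => map_zero _⟩
  smul_mem' c _ ha := ⟨L.smul_mem c ha.1, fun i hi => by rw [map_smul, ha.2 i hi]⟩

/-- The almost symmetric module `𝒫_as⁺ = ⋃ₙ 𝒫(n)⁺`. -/
def PAs (L : Submodule K (ℕ → R)) : Submodule K (ℕ → R) where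
  carrier := {F | ∃ n, F ∈ PSym L n}
  add_mem' := by
    rintro F G ⟨m, hF⟩ ⟨n, hG⟩
    exact ⟨max m n, add_mem hF.1 hG.1, fun i hi => by
      rw [map_add, hF.2 i ((le_max_left _ _).trans hi), hG.2 i ((le_max_right _ _).trans hi)]⟩
  zero_mem' := ⟨0, zero_mem _⟩
  smul_mem' := by
    rintro c F ⟨n, hF⟩
    exact ⟨n, (PSym L n).smul_mem c hF⟩

/-- `limₖ fₖ = F` for a sequence with `fₖ ∈ 𝒫ₖ⁺` for large `k`: there are `h` in the inverse limit,
finitely many almost symmetric `g_j`, and convergent sequences of scalars `a_{j,k} → b_j` with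
`fₖ = Πₖ h + ∑_j a_{j,k} Πₖ g_j`, and `F = h + ∑_j b_j g_j`.

The equation is required for all large `k` only, because `Ỹ_i⁽ᵏ⁾` exists only for `k ≥ i`. This
is no restriction: a single term `f_m ∈ 𝒫_m⁺` can be changed by any `g ∈ 𝒫_m⁺`, which is almost
symmetric, by means of the sequence of scalars that is `1` at `k = m` and `0` elsewhere. -/
def ConvergesTo (L : Submodule K (ℕ → R)) (f : ℕ → R) (F : ℕ → R) : Prop :=
  ∃ (N : ℕ) (h : ℕ → R) (g : Fin N → ℕ → R) (a : Fin N → ℕ → K) (b : Fin N → K),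
    h ∈ L ∧ (∀ j, g j ∈ PAs L) ∧ (∀ j, ScalarTendsTo (a j) (b j)) ∧
    (∀ᶠ k in atTop, f k = h k + ∑ j, a j k • g j k) ∧
    F = h + ∑ j, b j • g j

/-! ### The stable limit DAHA `ℋ⁺` -/

/-- The generators `T_i`, `X_i`, `Y_i` (`i : ℕ` stands for the index `i + 1`). -/
inductive Gen : Type
  | T (i : ℕ)
  | X (i : ℕ)
  | Y (i : ℕ)

/-- The free algebra on the generators. -/
abbrev Free : Type := FreeAlgebra K Gen

/-- The generator `T_i` in the free algebra. -/
def fT (i : ℕ) : Free := FreeAlgebra.ι K (Gen.T i)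

/-- The generator `X_i` in the free algebra. -/
def fX (i : ℕ) : Free := FreeAlgebra.ι K (Gen.X i)

/-- The generator `Y_i` in the free algebra. -/
def fY (i : ℕ) : Free := FreeAlgebra.ι K (Gen.Y i)

/-- A representative of `T_i⁻¹`: by the quadratic relation, `T_i` is invertible with inverse
`t⁻¹ (T_i + t - 1)`, see `HPlus.T_mul_Tinv` and `HPlus.Tinv_mul_T`. -/
def fTinv (i : ℕ) : Free := t⁻¹ • (fT i + algebraMap K Free (t - 1))

/-- The defining relations of `ℋ⁺`. -/
inductive Rel : Free → Free → Prop
  | T_comm (i j : ℕ) (h : i + 1 < j ∨ j + 1 < i) : Rel (fT i * fT j) (fT j * fT i)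
  | braid (i : ℕ) : Rel (fT i * fT (i + 1) * fT i) (fT (i + 1) * fT i * fT (i + 1))
  | quadratic (i : ℕ) : Rel ((fT i - 1) * (fT i + algebraMap K Free t)) 0
  | X_succ (i : ℕ) : Rel (t • (fTinv i * fX i * fTinv i)) (fX (i + 1))
  | T_X (i j : ℕ) (h₁ : j ≠ i) (h₂ : j ≠ i + 1) : Rel (fT i * fX j) (fX j * fT i)
  | X_comm (i j : ℕ) : Rel (fX i * fX j) (fX j * fX i)
  | Y_succ (i : ℕ) : Rel (t⁻¹ • (fT i * fY i * fT i)) (fY (i + 1))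
  | T_Y (i j : ℕ) (h₁ : j ≠ i) (h₂ : j ≠ i + 1) : Rel (fT i * fY j) (fY j * fT i)
  | Y_comm (i j : ℕ) : Rel (fY i * fY j) (fY j * fY i)
  | cross : Rel (fY 0 * fT 0 * fX 0) (fX 1 * fY 0 * fT 0)

/-- The `⁺`stable limit DAHA `ℋ⁺`. -/
def HPlus : Type := RingQuot Rel

instance HPlus.instRing : Ring HPlus := RingQuot.instRing Rel

instance HPlus.instAlgebra : Algebra K HPlus := RingQuot.instAlgebra Rel

namespace HPlus

/-- The canonical map from the free algebra. -/
def mk : Free →ₐ[K] HPlus := RingQuot.mkAlgHom K Rel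

/-- The generator `T_i` of `ℋ⁺`. -/
def T (i : ℕ) : HPlus := mk (fT i)

/-- The generator `X_i` of `ℋ⁺`. -/
def X (i : ℕ) : HPlus := mk (fX i)

/-- The generator `Y_i` of `ℋ⁺`. -/
def Y (i : ℕ) : HPlus := mk (fY i)

theorem quadratic (i : ℕ) : (T i - 1) * (T i + algebraMap K HPlus t) = 0 := by
  have h := RingQuot.mkAlgHom_rel K (Rel.quadratic i)
  rw [map_mul, map_sub, map_add, map_one, map_zero, AlgHom.commutes] at h
  exact h

theorem T_mul_Tinv (i : ℕ) : T i * mk (fTinv i) = 1 := by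
  have h := quadratic i
  have e : mk (fTinv i) = t⁻¹ • (T i + (algebraMap K HPlus t - 1)) := by
    simp only [fTinv, map_smul, map_add, AlgHom.commutes, map_sub, map_one, T]
  have h' : T i * (T i + (algebraMap K HPlus t - 1)) = algebraMap K HPlus t := by
    rw [← sub_eq_zero, ← h]
    simp only [mul_add, sub_mul, mul_sub, mul_one, one_mul]
    abel
  rw [e, mul_smul_comm, h', Algebra.algebraMap_eq_smul_one, smul_smul,
    inv_mul_cancel₀ t_ne_zero, one_smul]

theorem Tinv_mul_T (i : ℕ) : mk (fTinv i) * T i = 1 := by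
  have hc : mk (fTinv i) * T i = T i * mk (fTinv i) := by
    simp only [fTinv, map_smul, map_add, AlgHom.commutes, T, smul_mul_assoc, mul_smul_comm,
      add_mul, mul_add, Algebra.commutes]
  rw [hc, T_mul_Tinv]

end HPlus

/-- The representation `ρ` of `ℋ⁺` on `𝒫_as⁺` is the action by the limit operators: `T_i` and `X_i`
act as `𝒯_i` and `𝒳_i`, and `Y_i` acts as `𝒴_i F = limₖ Ỹ_i⁽ᵏ⁾ Πₖ F`. -/
def ActsByLimitOperators (L : Submodule K (ℕ → R))
    (ρ : HPlus →ₐ[K] Module.End K (PAs L)) : Prop :=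
  ∀ (i : ℕ) (F : PAs L),
    (ρ (HPlus.T i) F : ℕ → R) = limT i F ∧
    (ρ (HPlus.X i) F : ℕ → R) = limX i F ∧
    ConvergesTo L (fun k => Ytilde k i ((F : ℕ → R) k)) (ρ (HPlus.Y i) F : ℕ → R)

end StableDAHA

end

noncomputable section

namespace StableDAHA

/-! ### Substitutions -/

/-! Indices start at 0, and `y_0 = y` denotes the limit of the operators `Ytilde k 0`.

Existence of the limit. If `x 0` divides `f`, moving `x 0` through the chain of inverse `T`'s
produces a power of `t⁻¹` that cancels `t ^ k` up to one factor `t`. The result is divisible by `x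
0`, so `pr1` does nothing, and it is compatible with the inverse system: the limit is attained
exactly (`exists_Ytilde_zero_limX`). If `a` is fixed by `T_i` for `i ≥ n`, the chain turns `T_0 ⋯
T_{n-1} a` back into `a`, so `Ytilde k 0` gives `t ^ k` times a fixed element of the module, which
tends to `0`. Every almost symmetric element is a sum of two such elements (`exists_eq_upProd_add`),
by the decomposition `G = A + x_n B` of `exists_eq_add_limX`. Limits are unique because convergence
implies coefficientwise convergence, and a nonzero scalar has finite order at `t = 0`.

All relations other than the commutation of the `Y`'s pass to the limit, or follow formally from the
Hecke relations and from the commutation of `y` with `T_i`, `i ≥ 1`.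

Commutation. The deformed operators do not commute at finite level. They agree with the ordinary
commuting Cherednik operators on multiples of `x 0 * x 1`, and these multiples are preserved, so the
commutator `C_0 = [y_0, y_1]` vanishes on the image of `X 0 X 1`. With `C_i = [y_i, y_{i+1}]`, the
Hecke relations give `C_{i+1} = t⁻² T_i T_{i+1} C_i T_{i+1} T_i` and `C_i T_i⁻¹ = -t⁻¹ T_i C_i`.
Moreover `y_n` kills every vector fixed by `T_i` for `i ≥ n`, since its image under `T_0 ⋯ T_{n-1}`
is killed by `y`. For large `n` this forces `C_n` to vanish on a given level of the module
(`jucysComm_of_isFixed`); as the `T_i` are invertible, the conjugation formula carries the vanishing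
down to `C_0` (`jucysComm_zero`). Commutation of all `y_i` is then formal (`jucys_comm`).

The two inverse limits are treated together: only `IsDegreeClosed` is used of them. -/

theorem algHom_ext_x {φ ψ : R →ₐ[K] R} (h : ∀ j, φ (x j) = ψ (x j)) : φ = ψ :=
  MvPolynomial.algHom_ext h

theorem proj_x (k j : ℕ) : proj k (x j) = if j < k then x j else 0 := by
  simp [proj, x]

theorem cyc_x (k j : ℕ) : cyc k (x j) =
    if j + 1 < k then x (j + 1) else if j + 1 = k then q • x 0 else x j := by
  simp [cyc, x]

/-- The substitution `x_n = 0`. -/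
def kill (n : ℕ) : R →ₐ[K] R := MvPolynomial.aeval fun j => if j = n then (0 : R) else x j

theorem kill_x (n j : ℕ) : kill n (x j) = if j = n then 0 else x j := by
  simp [kill, x]

theorem pr1_apply (f : R) : pr1 f = f - kill 0 f := rfl

/-- The substitution `f ↦ f(x₀, …, x_{n-1}, 0, x_n, x_{n+1}, …)`. -/
def squeeze (n : ℕ) : R →ₐ[K] R :=
  MvPolynomial.aeval fun j => if j < n then x j else if j = n then (0 : R) else x (j - 1)

theorem squeeze_x (n j : ℕ) :
    squeeze n (x j) = if j < n then x j else if j = n then 0 else x (j - 1) := by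
  simp [squeeze, x]

theorem s_x_left (i : ℕ) : s i (x i) = x (i + 1) := by rw [s_x, Equiv.swap_apply_left]

theorem s_x_right (i : ℕ) : s i (x (i + 1)) = x i := by rw [s_x, Equiv.swap_apply_right]

theorem s_x_of_ne {i j : ℕ} (h₁ : j ≠ i) (h₂ : j ≠ i + 1) : s i (x j) = x j := by
  rw [s_x, Equiv.swap_apply_of_ne_of_ne h₁ h₂]

theorem s_x_eq (i j : ℕ) :
    s i (x j) = if j = i then x (i + 1) else if j = i + 1 then x i else x j := by
  split_ifs with h₁ h₂
  · rw [h₁, s_x_left]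
  · rw [h₂, s_x_right]
  · exact s_x_of_ne h₁ h₂

theorem comp_apply_eq {φ ψ φ' ψ' : R →ₐ[K] R}
    (h : ∀ j, φ (ψ (x j)) = φ' (ψ' (x j))) (f : R) : φ (ψ f) = φ' (ψ' f) :=
  DFunLike.congr_fun (algHom_ext_x (φ := φ.comp ψ) (ψ := φ'.comp ψ') h) f

theorem proj_proj {k m : ℕ} (h : k ≤ m) (f : R) : proj k (proj m f) = proj k f :=
  DFunLike.congr_fun (algHom_ext_x (φ := (proj k).comp (proj m)) (ψ := proj k) fun j => by
    simp only [AlgHom.comp_apply, proj_x]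
    split_ifs <;> simp [proj_x] <;> omega) f

theorem proj_mem_P (k : ℕ) (f : R) : proj k f ∈ P k := by
  induction f using MvPolynomial.induction_on with
  | C a => simpa using (P k).algebraMap_mem a
  | add a b ha hb => rw [map_add]; exact add_mem ha hb
  | mul_X a j ha =>
    change proj k (a * x j) ∈ P k
    rw [map_mul, proj_x]
    refine mul_mem ha ?_
    split_ifs with h
    · exact MvPolynomial.X_mem_supported.2 h
    · exact zero_mem _

theorem mem_P_iff {k : ℕ} {f : R} : f ∈ P k ↔ proj k f = f := by
  refine ⟨fun hf => ?_, fun hf => hf ▸ proj_mem_P k f⟩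
  change f ∈ MvPolynomial.supported K (Set.Iio k) at hf
  rw [MvPolynomial.supported_eq_adjoin_X] at hf
  induction hf using Algebra.adjoin_induction with
  | mem y hy =>
    obtain ⟨j, hj, rfl⟩ := hy
    change proj k (x j) = x j
    rw [proj_x, if_pos (by simpa using hj)]
  | algebraMap r => simp
  | add a b _ _ ha hb => rw [map_add, ha, hb]
  | mul a b _ _ ha hb => rw [map_mul, ha, hb]

theorem x_dvd_sub_kill (n : ℕ) (f : R) : x n ∣ f - kill n f := by
  induction f using MvPolynomial.induction_on with
  | C a => simp [kill]
  | add f g hf hg =>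
    rw [map_add, add_sub_add_comm]; exact dvd_add hf hg
  | mul_X f j hf =>
    change _ ∣ f * x j - kill n (f * x j)
    have : f * x j - kill n (f * x j) = (f - kill n f) * x j + kill n f * (x j - kill n (x j)) := by
      rw [map_mul]; ring
    rw [this]
    refine dvd_add (dvd_mul_of_dvd_left hf _) (dvd_mul_of_dvd_right ?_ _)
    rw [kill_x]
    split_ifs with h <;> simp [h]

theorem x_dvd_iff_kill {n : ℕ} {f : R} : x n ∣ f ↔ kill n f = 0 := by
  constructor
  · rintro ⟨g, rfl⟩
    rw [map_mul, kill_x, if_pos rfl, zero_mul]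
  · intro h
    simpa [h] using x_dvd_sub_kill n f

theorem x_ne_zero (i : ℕ) : x i ≠ 0 := MvPolynomial.X_ne_zero i

/-! ### Demazure–Lusztig operators -/

theorem T_apply (i : ℕ) (f : R) : T i f = s i f + (1 - t) • (x i * dd i f) := rfl

theorem s_eq_sub (i : ℕ) (f : R) : s i f = f - (x i - x (i + 1)) * dd i f := by
  rw [← dd_spec]; ring

theorem T_x_left (i : ℕ) (f : R) :
    T i (x i * f) = x (i + 1) * T i f + (1 - t) • (x i * f) := by
  have h : dd i (x i * f) = f + x (i + 1) * dd i f := dd_unique (by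
    rw [map_mul, s_x_left, s_eq_sub]; ring)
  simp only [T_apply, h, map_mul, s_x_left, MvPolynomial.smul_eq_C_mul]
  ring

theorem T_x_right (i : ℕ) (f : R) :
    T i (x (i + 1) * f) = x i * T i f + (t - 1) • (x i * f) := by
  have h : dd i (x (i + 1) * f) = x i * dd i f - f := dd_unique (by
    rw [map_mul, s_x_right, s_eq_sub]; ring)
  simp only [T_apply, h, map_mul, s_x_right, MvPolynomial.smul_eq_C_mul, map_sub, map_one]
  ring

theorem T_x_of_ne {i j : ℕ} (h₁ : j ≠ i) (h₂ : j ≠ i + 1) (f : R) :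
    T i (x j * f) = x j * T i f := by
  have h : dd i (x j * f) = x j * dd i f := dd_unique (by
    rw [map_mul, s_x_of_ne h₁ h₂, s_eq_sub]; ring)
  simp only [T_apply, h, map_mul, s_x_of_ne h₁ h₂, MvPolynomial.smul_eq_C_mul]
  ring

theorem T_C (i : ℕ) (a : K) : T i (MvPolynomial.C a) = MvPolynomial.C a := by
  have h : dd i (MvPolynomial.C a) = 0 := dd_unique (by simp [s])
  rw [T_apply, h]; simp [s]

theorem Tinv_apply (i : ℕ) (f : R) : Tinv i f = t⁻¹ • (T i f + (t - 1) • f) := rfl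

theorem T_eq_iff (i : ℕ) (f g : R) : T i f = g ↔ f = Tinv i g :=
  ⟨fun h => by rw [← h, Tinv_T], fun h => by rw [h, T_Tinv]⟩

theorem Tinv_x_left (i : ℕ) (f : R) : Tinv i (x i * f) = t⁻¹ • (x (i + 1) * T i f) := by
  rw [Tinv_apply, T_x_left]
  simp only [MvPolynomial.smul_eq_C_mul, map_sub, map_one]
  ring

theorem T_x_right_eq_Tinv (i : ℕ) (f : R) : T i (x (i + 1) * f) = t • (x i * Tinv i f) := by
  rw [T_x_right, Tinv_apply, mul_smul_comm, smul_smul, mul_inv_cancel₀ t_ne_zero, one_smul,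
    mul_add, mul_smul_comm]

theorem Tinv_x_of_ne {i j : ℕ} (h₁ : j ≠ i) (h₂ : j ≠ i + 1) (f : R) :
    Tinv i (x j * f) = x j * Tinv i f := by
  rw [Tinv_apply, Tinv_apply, T_x_of_ne h₁ h₂, mul_smul_comm, mul_add, mul_smul_comm]

/-- The rules for moving a variable through `T` determine the operator from its value on constants,
so it suffices that both sides treat each variable alike. The braid relation is proved in the same
way. -/
theorem T_comm {i j : ℕ} (h : i + 1 < j ∨ j + 1 < i) (f : R) : T i (T j f) = T j (T i f) := by
  induction f using MvPolynomial.induction_on with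
  | C a => simp only [T_C]
  | add f g hf hg => simp only [map_add, hf, hg]
  | mul_X f l hf =>
    change T i (T j (f * x l)) = T j (T i (f * x l))
    rw [mul_comm f]
    rcases eq_or_ne l i with rfl | hi
    · rw [T_x_of_ne (by omega) (by omega), T_x_left, T_x_left, map_add,
        T_x_of_ne (by omega) (by omega), map_smul, T_x_of_ne (by omega) (by omega), hf]
    rcases eq_or_ne l (i + 1) with rfl | hi'
    · rw [T_x_of_ne (by omega) (by omega), T_x_right, T_x_right, map_add,
        T_x_of_ne (by omega) (by omega), map_smul, T_x_of_ne (by omega) (by omega), hf]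
    rcases eq_or_ne l j with rfl | hj
    · rw [T_x_of_ne hi hi', T_x_left, T_x_left, map_add,
        T_x_of_ne (by omega) (by omega), map_smul, T_x_of_ne (by omega) (by omega), hf]
    rcases eq_or_ne l (j + 1) with rfl | hj'
    · rw [T_x_of_ne hi hi', T_x_right, T_x_right, map_add,
        T_x_of_ne (by omega) (by omega), map_smul, T_x_of_ne (by omega) (by omega), hf]
    rw [T_x_of_ne hj hj', T_x_of_ne hi hi', T_x_of_ne hi hi', T_x_of_ne hj hj', hf]

theorem T_braid (i : ℕ) (f : R) :
    T i (T (i + 1) (T i f)) = T (i + 1) (T i (T (i + 1) f)) := by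
  induction f using MvPolynomial.induction_on with
  | C a => simp only [T_C]
  | add f g hf hg => simp only [map_add, hf, hg]
  | mul_X f l hf =>
    change T i (T (i + 1) (T i (f * x l))) = T (i + 1) (T i (T (i + 1) (f * x l)))
    rw [mul_comm f]
    have e₁ : ∀ g, T i (x (i + 1 + 1) * g) = x (i + 1 + 1) * T i g :=
      T_x_of_ne (by omega) (by omega)
    have e₂ : ∀ g, T (i + 1) (x i * g) = x i * T (i + 1) g := T_x_of_ne (by omega) (by omega)
    rcases eq_or_ne l i with rfl | h₀
    · simp only [T_x_left, T_x_right, e₁, e₂, map_add, map_smul, T_T, hf]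
      simp only [MvPolynomial.smul_eq_C_mul, map_sub, map_one]
      ring
    rcases eq_or_ne l (i + 1) with rfl | h₁
    · simp only [T_x_left, T_x_right, e₁, e₂, map_add, map_smul, hf]
      simp only [MvPolynomial.smul_eq_C_mul, map_sub, map_one]
      ring
    rcases eq_or_ne l (i + 1 + 1) with rfl | h₂
    · simp only [T_x_right, e₁, e₂, map_add, map_smul, T_T, hf]
      simp only [MvPolynomial.smul_eq_C_mul, map_sub, map_one]
      ring
    rw [T_x_of_ne h₀ h₁, T_x_of_ne h₁ h₂, T_x_of_ne h₀ h₁, T_x_of_ne h₁ h₂, T_x_of_ne h₀ h₁,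
      T_x_of_ne h₁ h₂, hf]

/-- A common factor `c` on the two variables is harmless: `x_i` contributes one `c`, which is
exactly the one gained by the divided difference. The case `c = q` is needed for `cyc_cyc_T`. -/
theorem map_T {φ : R →ₐ[K] R} {i j : ℕ} (c : K) (hs : ∀ f, φ (s i f) = s j (φ f))
    (h₁ : φ (x i) = c • x j) (h₂ : φ (x (i + 1)) = c • x (j + 1)) (f : R) :
    φ (T i f) = T j (φ f) := by
  have h : dd j (φ f) = c • φ (dd i f) := dd_unique (by
    rw [← hs, ← map_sub, dd_spec, map_mul, map_sub, h₁, h₂, mul_smul_comm, ← smul_sub,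
      smul_mul_assoc])
  rw [T_apply, T_apply, h, map_add, hs, map_smul, map_mul, h₁, smul_mul_assoc, mul_smul_comm]

/-- One has `T_i f - f = (x_{i+1} - t x_i) dd_i f`, and the linear factor is nonzero. Invariance
under the Hecke operators thus becomes ordinary symmetry. -/
theorem T_eq_self_iff (i : ℕ) (f : R) : T i f = f ↔ s i f = f := by
  constructor
  · intro h
    have h₁ : (x (i + 1) - MvPolynomial.C t * x i) * dd i f = 0 := by
      have := s_eq_sub i f
      rw [T_apply, this, MvPolynomial.smul_eq_C_mul, map_sub, map_one] at h
      linear_combination h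
    have h₂ : x (i + 1) - MvPolynomial.C t * x i ≠ 0 := by
      intro h₀
      have := congrArg (kill i) h₀
      rw [map_sub, map_mul, kill_x, kill_x, if_pos rfl, if_neg (by omega)] at this
      simp [x_ne_zero] at this
    rw [s_eq_sub, (mul_eq_zero.1 h₁).resolve_left h₂, mul_zero, sub_zero]
  · intro h
    have : dd i f = 0 := dd_unique (by rw [h]; simp)
    rw [T_apply, h, this]; simp

theorem T_mul_of_s_eq {i : ℕ} {g : R} (hg : s i g = g) (f : R) : T i (g * f) = g * T i f := by
  have h : dd i (g * f) = g * dd i f := dd_unique (by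
    rw [map_mul, hg, s_eq_sub]; ring)
  simp only [T_apply, h, map_mul, hg, MvPolynomial.smul_eq_C_mul]
  ring

theorem proj_s {k i : ℕ} (h : i + 2 ≤ k) (f : R) : proj k (s i f) = s i (proj k f) :=
  comp_apply_eq (fun j => by
    simp only [s_x_eq, proj_x]
    split_ifs <;> simp [proj_x, s_x_eq] <;> grind) f

theorem proj_T {k i : ℕ} (h : i + 2 ≤ k) (f : R) : proj k (T i f) = T i (proj k f) :=
  map_T 1 (proj_s h) (by rw [proj_x, if_pos (by omega), one_smul])
    (by rw [proj_x, if_pos (by omega), one_smul]) f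

/-! ### Products of Demazure–Lusztig operators -/

/-- `T_{n-1} ⋯ T_1 T_0`. -/
def TChain : ℕ → (R →ₗ[K] R)
  | 0 => LinearMap.id
  | n + 1 => T n ∘ₗ TChain n

theorem TChain_succ (n : ℕ) (f : R) : TChain (n + 1) f = T n (TChain n f) := rfl

theorem TinvChain_succ (n : ℕ) (f : R) : TinvChain (n + 1) f = Tinv n (TinvChain n f) := rfl

theorem T_Tinv_comm {i j : ℕ} (h : i + 1 < j ∨ j + 1 < i) (f : R) :
    T i (Tinv j f) = Tinv j (T i f) := by
  rw [Tinv_apply, Tinv_apply, map_smul, map_add, map_smul, T_comm h]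

theorem Tinv_Tinv_T (i : ℕ) (f : R) :
    Tinv (i + 1) (Tinv i (T (i + 1) f)) = T i (Tinv (i + 1) (Tinv i f)) := by
  obtain ⟨g, rfl⟩ : ∃ g, f = T i (T (i + 1) g) :=
    ⟨Tinv (i + 1) (Tinv i f), by rw [T_Tinv, T_Tinv]⟩
  rw [← T_braid]
  simp only [Tinv_T]

theorem Tinv_Tinv_T' (i : ℕ) (f : R) :
    Tinv i (Tinv (i + 1) (T i f)) = T (i + 1) (Tinv i (Tinv (i + 1) f)) := by
  obtain ⟨g, rfl⟩ : ∃ g, f = T (i + 1) (T i g) :=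
    ⟨Tinv i (Tinv (i + 1) f), by rw [T_Tinv, T_Tinv]⟩
  rw [T_braid]
  simp only [Tinv_T]

theorem TinvChain_T_of_lt {m i : ℕ} (h : m < i) (f : R) :
    TinvChain m (T i f) = T i (TinvChain m f) := by
  induction m with
  | zero => rfl
  | succ m ih =>
    rw [TinvChain_succ, ih (by omega), ← T_Tinv_comm (by omega), TinvChain_succ]

theorem TinvChain_Tinv_of_lt {m i : ℕ} (h : m < i) (f : R) :
    TinvChain m (Tinv i f) = Tinv i (TinvChain m f) := by
  rw [Tinv_apply, Tinv_apply, map_smul, map_add, map_smul, TinvChain_T_of_lt h]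

/-- By the braid relation the chain lowers the index by one; `cyc` raises it again. This is why
`Ytilde k 0` commutes with `T_i` for `i ≥ 1`. -/
theorem TinvChain_T_succ {m i : ℕ} (h : i + 2 ≤ m) (f : R) :
    TinvChain m (T (i + 1) f) = T i (TinvChain m f) := by
  induction m with
  | zero => omega
  | succ m ih =>
    rcases (Nat.lt_or_eq_of_le h) with h' | h'
    · rw [TinvChain_succ, ih (by omega), ← T_Tinv_comm (by omega), TinvChain_succ]
    · obtain rfl : m = i + 1 := by omega
      rw [TinvChain_succ, TinvChain_succ, TinvChain_T_of_lt (by omega), Tinv_Tinv_T]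
      rfl

/-- Each step uses `T_i⁻¹ x_i = t⁻¹ x_{i+1} T_i`, so inverse operators become operators. The factor
`t⁻¹ ^ m` compensates `t ^ k` in the Cherednik operator. -/
theorem TinvChain_x_zero (m : ℕ) (f : R) :
    TinvChain m (x 0 * f) = t⁻¹ ^ m • (x m * TChain m f) := by
  induction m with
  | zero => simp [TinvChain, TChain]
  | succ m ih => rw [TinvChain_succ, ih, map_smul, Tinv_x_left, smul_smul, pow_succ, TChain_succ]

/-- The first factor of the chain cancels `T 0`, and the others commute with `x 0`. With `cyc`
sending `x 0` to `x 1`, this is the source of the cross relation. -/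
theorem TinvChain_T_zero_x (m : ℕ) (f : R) :
    TinvChain (m + 1) (T 0 (x 0 * f)) = x 0 * TinvChain (m + 1) (T 0 f) := by
  induction m with
  | zero => simp [TinvChain, Tinv_T]
  | succ m ih =>
    rw [TinvChain_succ, ih, Tinv_x_of_ne (by omega) (by omega), TinvChain_succ (m + 1)]

/-- The pair of chains carries `T 0` to `T m`. The square of `cyc` carries `T m` back to `T 0` by
`cyc_cyc_T`, and together they make the Cherednik operators commute. -/
theorem TinvChain_TinvChain_T_zero (m : ℕ) (f : R) :
    TinvChain m (TinvChain (m + 1) (T 0 f)) = T m (TinvChain m (TinvChain (m + 1) f)) := by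
  induction m with
  | zero => simp [TinvChain, Tinv_T, T_Tinv]
  | succ m ih =>
    have e (g : R) : TinvChain (m + 1) (TinvChain (m + 1 + 1) g) =
        Tinv m (Tinv (m + 1) (TinvChain m (TinvChain (m + 1) g))) := by
      rw [← TinvChain_Tinv_of_lt (by omega)]
      rfl
    rw [e, e, ih, Tinv_Tinv_T']

theorem proj_TChain {k m : ℕ} (h : m + 1 ≤ k) (f : R) :
    proj k (TChain m f) = TChain m (proj k f) := by
  induction m with
  | zero => rfl
  | succ m ih => rw [TChain_succ, proj_T (by omega), ih (by omega), TChain_succ]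

theorem x_zero_dvd_TChain (m : ℕ) (f : R) : x 0 ∣ TChain (m + 1) (x 1 * f) := by
  induction m with
  | zero =>
    change x 0 ∣ T 0 (x 1 * f)
    rw [T_x_right_eq_Tinv 0 f, ← mul_smul_comm]
    exact dvd_mul_right _ _
  | succ m ih =>
    obtain ⟨g, hg⟩ := ih
    rw [TChain_succ, hg, T_x_of_ne (by omega) (by omega)]
    exact dvd_mul_right _ _

/-! ### The rotation `cyc` -/

theorem cyc_x_of_lt {k j : ℕ} (h : j + 1 < k) : cyc k (x j) = x (j + 1) := by
  rw [cyc_x, if_pos h]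

theorem cyc_x_last (j : ℕ) : cyc (j + 1) (x j) = q • x 0 := by
  rw [cyc_x, if_neg (by omega), if_pos rfl]

theorem cyc_x_of_le {k j : ℕ} (h : k ≤ j) : cyc k (x j) = x j := by
  rw [cyc_x, if_neg (by omega), if_neg (by omega)]

theorem cyc_s {k i : ℕ} (h : i + 2 < k) (f : R) : cyc k (s i f) = s (i + 1) (cyc k f) :=
  comp_apply_eq (fun j => by
    simp only [s_x_eq, cyc_x]
    split_ifs <;> simp [cyc_x, s_x_eq] <;> grind) f

theorem cyc_T {k i : ℕ} (h : i + 2 < k) (f : R) : cyc k (T i f) = T (i + 1) (cyc k f) :=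
  map_T 1 (cyc_s h) (by rw [cyc_x, if_pos (by omega), one_smul])
    (by rw [cyc_x, if_pos (by omega), one_smul]) f

theorem cyc_Tinv {k i : ℕ} (h : i + 2 < k) (f : R) :
    cyc k (Tinv i f) = Tinv (i + 1) (cyc k f) := by
  rw [Tinv_apply, Tinv_apply, map_smul, map_add, map_smul, cyc_T h]

theorem cyc_cyc_s (m : ℕ) (f : R) :
    cyc (m + 2) (cyc (m + 2) (s m f)) = s 0 (cyc (m + 2) (cyc (m + 2) f)) := by
  have h : ((cyc (m + 2)).comp (cyc (m + 2))).comp (s m) =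
      (s 0).comp ((cyc (m + 2)).comp (cyc (m + 2))) := algHom_ext_x fun j => by
    simp only [AlgHom.comp_apply]
    rcases lt_trichotomy j m with h | rfl | h
    · rw [s_x_of_ne (by omega) (by omega), cyc_x_of_lt (by omega), cyc_x_of_lt (by omega),
        s_x_of_ne (by omega) (by omega)]
    · rw [s_x_left, cyc_x_last, map_smul, cyc_x_of_lt (by omega), cyc_x_of_lt (by omega),
        cyc_x_last, map_smul, s_x_left]
    rcases eq_or_ne j (m + 1) with rfl | h'
    · rw [s_x_right, cyc_x_of_lt (by omega), cyc_x_last, map_smul, cyc_x_of_lt (by omega),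
        map_smul, s_x_right]
    · rw [s_x_of_ne (by omega) (by omega), cyc_x_of_le (by omega), cyc_x_of_le (by omega),
        s_x_of_ne (by omega) (by omega)]
  exact DFunLike.congr_fun h f

theorem cyc_cyc_T (m : ℕ) (f : R) :
    cyc (m + 2) (cyc (m + 2) (T m f)) = T 0 (cyc (m + 2) (cyc (m + 2) f)) := by
  have h := map_T (φ := (cyc (m + 2)).comp (cyc (m + 2))) (i := m) (j := 0) q
    (fun f => by simp only [AlgHom.comp_apply, cyc_cyc_s])
    (by simp [cyc_x]) (by simp [cyc_x]) f
  simpa only [AlgHom.comp_apply] using h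

theorem proj_cyc {k : ℕ} (f : R) : proj (k + 1) (cyc (k + 1) f) = cyc (k + 1) (proj (k + 1) f) :=
  comp_apply_eq (fun j => by
    simp only [proj_x, cyc_x]
    split_ifs <;> simp [cyc_x, proj_x] <;> grind) f

theorem proj_cyc_s (k : ℕ) (f : R) :
    proj (k + 1) (cyc (k + 2) (s k f)) = cyc (k + 1) (proj (k + 1) f) := by
  have h : ((proj (k + 1)).comp (cyc (k + 2))).comp (s k) =
      (cyc (k + 1)).comp (proj (k + 1)) := algHom_ext_x fun j => by
    simp only [AlgHom.comp_apply]
    rcases lt_trichotomy j k with h | rfl | h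
    · rw [s_x_of_ne (by omega) (by omega), cyc_x_of_lt (by omega), proj_x, proj_x,
        if_pos (by omega), if_pos (by omega), cyc_x_of_lt (by omega)]
    · rw [s_x_left, cyc_x_last, map_smul, proj_x, proj_x, if_pos (by omega), if_pos (by omega),
        cyc_x_last]
    rcases eq_or_ne j (k + 1) with rfl | h'
    · rw [s_x_right, cyc_x_of_lt (by omega), proj_x, if_neg (by omega), map_zero]
    · rw [s_x_of_ne (by omega) (by omega), cyc_x_of_le (by omega), proj_x, if_neg (by omega),
        map_zero]
  exact DFunLike.congr_fun h f

/-- The correction term of `T k` contains `x k`, which `cyc (k + 2)` moves to `x (k + 1)` and `proj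
(k + 1)` kills. What remains is the compatibility of `cyc ∘ TChain` with the inverse system. -/
theorem proj_cyc_T (k : ℕ) (f : R) :
    proj (k + 1) (cyc (k + 2) (T k f)) = cyc (k + 1) (proj (k + 1) f) := by
  rw [T_apply, map_add, map_add, proj_cyc_s]
  simp [cyc_x, proj_x]

/-! ### Commutation of `pr₁` -/

theorem kill_proj (n k : ℕ) (f : R) : kill n (proj k f) = proj k (kill n f) :=
  comp_apply_eq (fun j => by
    simp only [proj_x, kill_x]
    split_ifs <;> simp [kill_x, proj_x] <;> grind) f

theorem kill_s {n i : ℕ} (h : n < i) (f : R) : kill n (s i f) = s i (kill n f) :=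
  comp_apply_eq (fun j => by
    simp only [s_x_eq, kill_x]
    split_ifs <;> simp [kill_x, s_x_eq] <;> grind) f

theorem kill_T {n i : ℕ} (h : n < i) (f : R) : kill n (T i f) = T i (kill n f) :=
  map_T 1 (kill_s h) (by rw [kill_x, if_neg (by omega), one_smul])
    (by rw [kill_x, if_neg (by omega), one_smul]) f

theorem pr1_T {i : ℕ} (h : 0 < i) (f : R) : pr1 (T i f) = T i (pr1 f) := by
  rw [pr1_apply, pr1_apply, kill_T h, map_sub]

theorem pr1_proj (k : ℕ) (f : R) : pr1 (proj k f) = proj k (pr1 f) := by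
  rw [pr1_apply, pr1_apply, kill_proj, map_sub]

theorem pr1_x_mul {i : ℕ} (h : i ≠ 0) (f : R) : pr1 (x i * f) = x i * pr1 f := by
  rw [pr1_apply, pr1_apply, map_mul, kill_x, if_neg h, mul_sub]

theorem pr1_of_dvd {f : R} (h : x 0 ∣ f) : pr1 f = f := by
  rw [pr1_apply, x_dvd_iff_kill.1 h, sub_zero]

/-! ### The deformed Cherednik operators -/

/-- The Cherednik operator `tᵏ cyc T_{k-2}⁻¹ ⋯ T_0⁻¹`, without the projection `pr₁`. -/
def cherednik (k : ℕ) : R →ₗ[K] R := t ^ k • ((cyc k).toLinearMap ∘ₗ TinvChain (k - 1))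

theorem cherednik_apply (k : ℕ) (f : R) :
    cherednik k f = t ^ k • cyc k (TinvChain (k - 1) f) := rfl

theorem Ytilde_zero_apply (k : ℕ) (f : R) :
    Ytilde k 0 f = t ^ k • pr1 (cyc k (TinvChain (k - 1) f)) := rfl

theorem Ytilde_succ_apply (k i : ℕ) (f : R) :
    Ytilde k (i + 1) f = t⁻¹ • T i (Ytilde k i (T i f)) := rfl

theorem Ytilde_zero_eq_pr1 (k : ℕ) (f : R) : Ytilde k 0 f = pr1 (cherednik k f) := by
  rw [cherednik_apply, map_smul, Ytilde_zero_apply]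

theorem Ytilde_zero_T {k i : ℕ} (hi : 0 < i) (hk : i + 1 < k) (f : R) :
    Ytilde k 0 (T i f) = T i (Ytilde k 0 f) := by
  obtain ⟨i, rfl⟩ : ∃ j, i = j + 1 := ⟨i - 1, by omega⟩
  rw [Ytilde_zero_apply, Ytilde_zero_apply, TinvChain_T_succ (by omega), cyc_T (by omega),
    pr1_T (by omega), map_smul]

theorem cherednik_x_zero (k : ℕ) (f : R) :
    cherednik (k + 1) (x 0 * f) = (t * q) • (x 0 * cyc (k + 1) (TChain k f)) := by
  rw [cherednik_apply, Nat.add_sub_cancel, TinvChain_x_zero, map_smul, map_mul, cyc_x,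
    if_neg (by omega), if_pos rfl, smul_mul_assoc, smul_smul, smul_smul]
  congr 1
  have := t_ne_zero
  rw [pow_succ, mul_right_comm _ t, ← mul_pow, mul_inv_cancel₀ this, one_pow, one_mul]

theorem Ytilde_zero_of_dvd {k : ℕ} {f : R} (h : x 0 ∣ f) :
    Ytilde (k + 1) 0 f = cherednik (k + 1) f := by
  obtain ⟨g, rfl⟩ := h
  rw [Ytilde_zero_eq_pr1, pr1_of_dvd]
  rw [cherednik_x_zero, ← mul_smul_comm]
  exact dvd_mul_right _ _

theorem Ytilde_zero_T_zero_x (k : ℕ) (f : R) :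
    Ytilde (k + 2) 0 (T 0 (x 0 * f)) = x 1 * Ytilde (k + 2) 0 (T 0 f) := by
  rw [Ytilde_zero_apply, Ytilde_zero_apply, show k + 2 - 1 = k + 1 from rfl, TinvChain_T_zero_x,
    map_mul, cyc_x, if_pos (by omega), pr1_x_mul (by omega), mul_smul_comm]

/-- `T 0` cancels the first factor; the remaining ones have positive index and pass through `cyc`
with index lowered by one. -/
theorem TinvChain_T_zero_cyc {k j : ℕ} (h : j + 1 < k) (f : R) :
    TinvChain (j + 1) (T 0 (cyc k f)) = cyc k (TinvChain j f) := by
  induction j with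
  | zero => simp [TinvChain, Tinv_T]
  | succ j ih => rw [TinvChain_succ, ih (by omega), ← cyc_Tinv (by omega), TinvChain_succ]

theorem cherednik_T_cherednik (k : ℕ) (f : R) :
    cherednik (k + 2) (T 0 (cherednik (k + 2) f)) =
      (t ^ (k + 2) * t ^ (k + 2)) •
        cyc (k + 2) (cyc (k + 2) (TinvChain k (TinvChain (k + 1) f))) := by
  rw [cherednik_apply, cherednik_apply, show k + 2 - 1 = k + 1 from rfl, map_smul, map_smul,
    TinvChain_T_zero_cyc (by omega), map_smul, smul_smul]

theorem cherednik_comm (k : ℕ) (f : R) :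
    cherednik (k + 2) (T 0 (cherednik (k + 2) (T 0 f))) =
      T 0 (cherednik (k + 2) (T 0 (cherednik (k + 2) f))) := by
  rw [cherednik_T_cherednik, cherednik_T_cherednik, TinvChain_TinvChain_T_zero, cyc_cyc_T, map_smul]

theorem dvd_T_zero {f : R} (h : x 0 * x 1 ∣ f) : x 0 * x 1 ∣ T 0 f := by
  obtain ⟨g, rfl⟩ := h
  rw [T_mul_of_s_eq (by rw [map_mul, s_x_left, s_x_right 0, mul_comm])]
  exact dvd_mul_right _ _

/-- The factor `x 0` survives because it is pulled out by `cherednik_x_zero`. The factor `x 1`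
becomes `x 0` under the first `T` of the chain, and `cyc` turns it into `x 1` again. -/
theorem dvd_cherednik {k : ℕ} {f : R} (h : x 0 * x 1 ∣ f) :
    x 0 * x 1 ∣ cherednik (k + 2) f := by
  obtain ⟨g, rfl⟩ := h
  rw [mul_assoc, cherednik_x_zero]
  obtain ⟨p, hp⟩ := x_zero_dvd_TChain k g
  rw [hp, map_mul, cyc_x, if_pos (by omega), ← mul_assoc, ← mul_smul_comm]
  exact dvd_mul_right _ _

theorem dvd_Ytilde_zero {k : ℕ} {f : R} (h : x 0 * x 1 ∣ f) :
    x 0 * x 1 ∣ Ytilde (k + 2) 0 f := by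
  rw [Ytilde_zero_of_dvd ((dvd_mul_right _ _).trans h)]
  exact dvd_cherednik h

/-- Multiples of `x 0 * x 1` are stable under `T 0` and the Cherednik operator, so every projection
`pr1` in the two words acts as the identity. -/
theorem Ytilde_zero_comm_of_dvd {k : ℕ} {f : R} (h : x 0 * x 1 ∣ f) :
    Ytilde (k + 2) 0 (T 0 (Ytilde (k + 2) 0 (T 0 f))) =
      T 0 (Ytilde (k + 2) 0 (T 0 (Ytilde (k + 2) 0 f))) := by
  have key : ∀ {g : R}, x 0 * x 1 ∣ g → Ytilde (k + 2) 0 g = cherednik (k + 2) g :=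
    fun hg => Ytilde_zero_of_dvd ((dvd_mul_right _ _).trans hg)
  rw [key (dvd_T_zero h), key (dvd_T_zero (dvd_cherednik (dvd_T_zero h))), key h,
    key (dvd_T_zero (dvd_cherednik h)), cherednik_comm]

/-! ### The inverse limit -/

theorem mem_PInf_iff {F : ℕ → R} :
    F ∈ PInf ↔ ∀ k, proj k (F k) = F k ∧ proj k (F (k + 1)) = F k :=
  forall_congr' fun _ => and_congr_left' mem_P_iff

theorem proj_of_mem_PInf {F : ℕ → R} (hF : F ∈ PInf) {k m : ℕ} (h : k ≤ m) :
    proj k (F m) = F k := by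
  rw [mem_PInf_iff] at hF
  induction m, h using Nat.le_induction with
  | base => exact (hF k).1
  | succ m h ih => rw [← ih, ← (hF m).2, proj_proj h]

theorem PInf_ext {F G : ℕ → R} (hF : F ∈ PInf) (hG : G ∈ PInf)
    (h : ∀ᶠ k in atTop, F k = G k) : F = G := by
  obtain ⟨N, hN⟩ := eventually_atTop.1 h
  funext k
  rw [← proj_of_mem_PInf hF (le_max_left k N), ← proj_of_mem_PInf hG (le_max_left k N),
    hN _ (le_max_right k N)]

/-- A sequence that is compatible with the inverse system from the index `m` on. -/
def Compatible (m : ℕ) (f : ℕ → R) : Prop :=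
  ∀ k, m ≤ k → proj k (f k) = f k ∧ proj k (f (k + 1)) = f k

/-- The element of the inverse limit given by a sequence that is compatible from the index `m`
on. -/
def extend (m : ℕ) (f : ℕ → R) : ℕ → R := fun k => proj k (f (max k m))

theorem extend_apply {m : ℕ} {f : ℕ → R} (hf : Compatible m f) {k : ℕ} (h : m ≤ k) :
    extend m f k = f k := by
  rw [extend, max_eq_left h, (hf k h).1]

theorem extend_mem_PInf {m : ℕ} {f : ℕ → R} (hf : Compatible m f) : extend m f ∈ PInf := by
  refine mem_PInf_iff.2 fun k => ⟨proj_proj le_rfl _, ?_⟩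
  rw [extend, extend, proj_proj (Nat.le_succ k)]
  rcases Nat.lt_or_ge k m with h | h
  · rw [max_eq_right h, max_eq_right h.le]
  · rw [max_eq_left h, max_eq_left (by omega), (hf k h).2, (hf k h).1]

theorem compatible_T {F : ℕ → R} (hF : F ∈ PInf) (i : ℕ) :
    Compatible (i + 2) fun k => T i (F k) := fun k hk => by
  rw [proj_T hk, proj_T hk, (mem_PInf_iff.1 hF k).1, (mem_PInf_iff.1 hF k).2]
  exact ⟨rfl, rfl⟩

theorem limT_eq_extend (i : ℕ) (F : ℕ → R) : limT i F = extend (i + 2) fun k => T i (F k) := rfl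

theorem limT_apply {F : ℕ → R} (hF : F ∈ PInf) {i k : ℕ} (h : i + 2 ≤ k) :
    limT i F k = T i (F k) := by
  rw [limT_eq_extend, extend_apply (compatible_T hF i) h]

theorem limX_apply (F : ℕ → R) {i k : ℕ} (h : i < k) : limX i F k = x i * F k := by
  change proj k (x i) * F k = _
  rw [proj_x, if_pos h]

/-! ### Degrees -/

theorem totalDegree_aeval_le {g : ℕ → R} (hg : ∀ j, (g j).totalDegree ≤ 1) (f : R) :
    (MvPolynomial.aeval g f : R).totalDegree ≤ f.totalDegree := by
  rw [MvPolynomial.aeval_def, MvPolynomial.eval₂_eq]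
  refine MvPolynomial.totalDegree_finsetSum_le fun d hd => ?_
  refine (MvPolynomial.totalDegree_mul _ _).trans ?_
  rw [MvPolynomial.algebraMap_eq, MvPolynomial.totalDegree_C, zero_add]
  refine (MvPolynomial.totalDegree_finsetProd _ _).trans
    (le_trans (Finset.sum_le_sum fun i _ => ?_) (MvPolynomial.le_totalDegree hd))
  exact (MvPolynomial.totalDegree_pow _ _).trans (by simpa using Nat.mul_le_mul_left (d i) (hg i))

theorem totalDegree_x_le (i : ℕ) : (x i).totalDegree ≤ 1 := (MvPolynomial.totalDegree_X i).le

theorem totalDegree_proj_le (k : ℕ) (f : R) : (proj k f).totalDegree ≤ f.totalDegree :=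
  totalDegree_aeval_le (fun j => by split_ifs <;> simp [totalDegree_x_le]) f

theorem totalDegree_squeeze_le (k : ℕ) (f : R) : (squeeze k f).totalDegree ≤ f.totalDegree :=
  totalDegree_aeval_le (fun j => by split_ifs <;> simp [totalDegree_x_le]) f

theorem totalDegree_kill_le (k : ℕ) (f : R) : (kill k f).totalDegree ≤ f.totalDegree :=
  totalDegree_aeval_le (fun j => by split_ifs <;> simp [totalDegree_x_le]) f

theorem totalDegree_cyc_le (k : ℕ) (f : R) : (cyc k f).totalDegree ≤ f.totalDegree :=
  totalDegree_aeval_le (fun j => by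
    split_ifs
    · exact totalDegree_x_le _
    · exact (MvPolynomial.totalDegree_smul_le _ _).trans (totalDegree_x_le _)
    · exact totalDegree_x_le _) f

theorem totalDegree_pr1_le (f : R) : (pr1 f).totalDegree ≤ f.totalDegree := by
  rw [pr1_apply]
  exact (MvPolynomial.totalDegree_sub _ _).trans (max_le le_rfl (totalDegree_kill_le 0 f))

theorem totalDegree_x_mul {g : R} (i : ℕ) (hg : g ≠ 0) :
    (x i * g).totalDegree = g.totalDegree + 1 := by
  rw [MvPolynomial.totalDegree_mul_of_isDomain (x_ne_zero i) hg, x, MvPolynomial.totalDegree_X,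
    add_comm]

theorem totalDegree_x_mul_le (i : ℕ) (g : R) : (x i * g).totalDegree ≤ g.totalDegree + 1 := by
  refine (MvPolynomial.totalDegree_mul _ _).trans ?_
  have := totalDegree_x_le i
  omega

theorem totalDegree_le_x_mul (i : ℕ) (g : R) : g.totalDegree ≤ (x i * g).totalDegree := by
  rcases eq_or_ne g 0 with rfl | hg
  · simp
  · rw [totalDegree_x_mul i hg]; omega

theorem totalDegree_s_le (i : ℕ) (f : R) : (s i f).totalDegree ≤ f.totalDegree :=
  MvPolynomial.totalDegree_rename_le _ _

theorem totalDegree_T_le (i : ℕ) (f : R) : (T i f).totalDegree ≤ f.totalDegree := by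
  rw [T_apply]
  refine (MvPolynomial.totalDegree_add _ _).trans (max_le (totalDegree_s_le i f) ?_)
  refine (MvPolynomial.totalDegree_smul_le _ _).trans ?_
  rcases eq_or_ne (dd i f) 0 with h | h
  · simp [h]
  have h₁ := congrArg MvPolynomial.totalDegree (dd_spec i f)
  rw [MvPolynomial.totalDegree_mul_of_isDomain (x_sub_ne_zero i) h] at h₁
  have h₂ := (MvPolynomial.totalDegree_sub f (s i f)).trans (max_le le_rfl (totalDegree_s_le i f))
  -- A constant would be fixed by `s i`, whereas this difference changes sign. Hence the divisor has
  -- positive degree, which pays for the factor `x i` in `T i`.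
  have h₃ : (x i - x (i + 1)).totalDegree ≠ 0 := by
    intro h₀
    rw [MvPolynomial.totalDegree_eq_zero_iff_eq_C] at h₀
    have h₄ := congrArg (s i) h₀
    have h₅ : s i (MvPolynomial.C ((x i - x (i + 1)).coeff 0)) =
        MvPolynomial.C ((x i - x (i + 1)).coeff 0) := (s i).commutes _
    rw [h₅, ← h₀, map_sub, s_x_left, s_x_right] at h₄
    have h₆ : (2 : R) * (x i - x (i + 1)) = 0 := by linear_combination -h₄
    exact x_sub_ne_zero i ((mul_eq_zero.1 h₆).resolve_left two_ne_zero)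
  rw [totalDegree_x_mul i h]
  omega

theorem totalDegree_TChain_le (m : ℕ) (f : R) : (TChain m f).totalDegree ≤ f.totalDegree := by
  induction m with
  | zero => simp [TChain]
  | succ m ih => rw [TChain_succ]; exact (totalDegree_T_le _ _).trans ih

/-! ### The two versions of the inverse limit -/

/-- A submodule of the inverse limit that is cut out by a condition on degrees. -/
structure IsDegreeClosed (L : Submodule K (ℕ → R)) : Prop where
  le : L ≤ PInf
  mem : ∀ F ∈ L, ∀ G ∈ PInf, ∀ c : ℕ,
    (∀ k, ∃ m, (G k).totalDegree ≤ (F m).totalDegree + c) → G ∈ L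

theorem isDegreeClosed_PInf : IsDegreeClosed PInf := ⟨le_rfl, fun _ _ _ hG _ _ => hG⟩

theorem isDegreeClosed_PInfGr : IsDegreeClosed PInfGr := by
  refine ⟨fun F hF => hF.1, ?_⟩
  rintro F ⟨_, d, hd⟩ G hG c h
  refine ⟨hG, d + c, fun k => ?_⟩
  obtain ⟨m, hm⟩ := h k
  exact hm.trans (Nat.add_le_add_right (hd m) c)

namespace IsDegreeClosed

variable {L : Submodule K (ℕ → R)}

theorem extend_mem (hL : IsDegreeClosed L) {F : ℕ → R} (hF : F ∈ L) {m : ℕ} {f : ℕ → R}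
    (hf : Compatible m f) (c : ℕ)
    (h : ∀ k, m ≤ k → ∃ l, (f k).totalDegree ≤ (F l).totalDegree + c) : extend m f ∈ L := by
  refine hL.mem F hF _ (extend_mem_PInf hf) c fun k => ?_
  obtain ⟨l, hl⟩ := h (max k m) (le_max_right k m)
  exact ⟨l, (totalDegree_proj_le _ _).trans hl⟩

theorem limT_mem (hL : IsDegreeClosed L) {F : ℕ → R} (hF : F ∈ L) (i : ℕ) : limT i F ∈ L := by
  rw [limT_eq_extend]
  exact hL.extend_mem hF (compatible_T (hL.le hF) i) 0 fun k _ => ⟨k, totalDegree_T_le _ _⟩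

theorem limX_mem (hL : IsDegreeClosed L) {F : ℕ → R} (hF : F ∈ L) (i : ℕ) : limX i F ∈ L := by
  have hF' := mem_PInf_iff.1 (hL.le hF)
  refine hL.mem F hF _ (mem_PInf_iff.2 fun k => ?_) 1 fun k => ⟨k, ?_⟩
  · change proj k (proj k (x i) * F k) = _ ∧ proj k (proj (k + 1) (x i) * F (k + 1)) = _
    rw [map_mul, map_mul, proj_proj le_rfl, proj_proj (Nat.le_succ k), (hF' k).1, (hF' k).2]
    exact ⟨rfl, rfl⟩
  · refine (MvPolynomial.totalDegree_mul _ _).trans ?_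
    have := (totalDegree_proj_le k (x i)).trans (totalDegree_x_le i)
    change (proj k (x i)).totalDegree + _ ≤ _
    omega

theorem mem_PSym_iff (hL : IsDegreeClosed L) {F : ℕ → R} {n : ℕ} :
    F ∈ PSym L n ↔ F ∈ L ∧ ∀ i k, n ≤ i → i + 2 ≤ k → s i (F k) = F k := by
  refine and_congr_right fun hF => ⟨fun h i k hi hk => ?_, fun h i hi => ?_⟩
  · rw [← T_eq_self_iff, ← limT_apply (hL.le hF) hk, h i hi]
  · refine PInf_ext (hL.le (hL.limT_mem hF i)) (hL.le hF) ?_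
    filter_upwards [eventually_ge_atTop (i + 2)] with k hk
    rw [limT_apply (hL.le hF) hk, T_eq_self_iff, h i k hi hk]

theorem exists_limX_eq (hL : IsDegreeClosed L) {F : ℕ → R} (hF : F ∈ L) {n : ℕ}
    (h : ∀ᶠ k in atTop, x n ∣ F k) : ∃ B ∈ L, F = limX n B := by
  -- Divisibility at a large level descends to every level containing `x n`, by projection.
  have h' : ∀ k, n < k → x n ∣ F k := fun k hk => by
    obtain ⟨N, hN⟩ := eventually_atTop.1 h
    have h₁ := map_dvd (proj k) (hN _ (le_max_right k N))
    rwa [proj_of_mem_PInf (hL.le hF) (le_max_left k N), proj_x, if_pos hk] at h₁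
  choose! b hb using h'
  have hF' := mem_PInf_iff.1 (hL.le hF)
  have hb' : Compatible (n + 1) b := fun k hk => by
    have h₁ : proj k (x n) = x n := by rw [proj_x, if_pos (by omega)]
    refine ⟨mul_left_cancel₀ (x_ne_zero n) ?_, mul_left_cancel₀ (x_ne_zero n) ?_⟩
    · rw [← hb k (by omega), ← (hF' k).1, hb k (by omega), map_mul, h₁]
    · rw [← hb k (by omega), ← (hF' k).2, hb (k + 1) (by omega), map_mul, h₁]
  have hB : extend (n + 1) b ∈ L := hL.extend_mem hF hb' 0 fun k hk => ⟨k, by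
    rw [hb k (by omega)]; exact totalDegree_le_x_mul n _⟩
  refine ⟨_, hB, PInf_ext (hL.le hF) (hL.le (hL.limX_mem hB n)) ?_⟩
  filter_upwards [eventually_gt_atTop n] with k hk
  rw [limX_apply _ hk, extend_apply hb' hk, hb k hk]

end IsDegreeClosed

/-! ### Decomposition of almost symmetric elements -/

theorem squeeze_succ_s (n : ℕ) (f : R) : squeeze (n + 1) (s n f) = squeeze n f := by
  have h : (squeeze (n + 1)).comp (s n) = squeeze n := algHom_ext_x fun j => by
    simp only [AlgHom.comp_apply, s_x_eq, squeeze_x]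
    split_ifs <;> simp [squeeze_x] <;> grind
  exact DFunLike.congr_fun h f

theorem proj_squeeze {n k : ℕ} (h : n ≤ k) (f : R) :
    proj k (squeeze n f) = squeeze n (proj (k + 1) f) :=
  comp_apply_eq (fun j => by
    simp only [proj_x, squeeze_x]
    split_ifs <;> simp [squeeze_x, proj_x] <;> grind) f

theorem s_squeeze {n i : ℕ} (h : n ≤ i) (f : R) : s i (squeeze n f) = squeeze n (s (i + 1) f) :=
  comp_apply_eq (fun j => by
    simp only [s_x_eq, squeeze_x]
    split_ifs <;> simp [squeeze_x, s_x_eq] <;> grind) f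

theorem kill_squeeze (n : ℕ) (f : R) : kill n (squeeze n f) = kill n (squeeze (n + 1) f) :=
  comp_apply_eq (fun j => by
    simp only [squeeze_x]
    split_ifs <;> simp [kill_x] <;> grind) f

theorem squeeze_proj (k : ℕ) (f : R) : squeeze k (proj (k + 1) f) = proj k f := by
  have h : (squeeze k).comp (proj (k + 1)) = proj k := algHom_ext_x fun j => by
    simp only [AlgHom.comp_apply, proj_x]
    split_ifs <;> simp [squeeze_x] <;> grind
  exact DFunLike.congr_fun h f

/-- By symmetry it does not matter which of the variables from `x n` on is set to zero. Moving the
zero up to the last variable `x k` turns `squeeze` into the structure map of the inverse system. -/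
theorem squeeze_of_mem_PSym {L : Submodule K (ℕ → R)} (hL : IsDegreeClosed L) {G : ℕ → R} {n : ℕ}
    (hG : G ∈ PSym L n) {k : ℕ} (hk : n ≤ k) : squeeze n (G (k + 1)) = G k := by
  rw [hL.mem_PSym_iff] at hG
  have hG' := mem_PInf_iff.1 (hL.le hG.1)
  have key : ∀ d m, m + d = k → n ≤ m → squeeze m (G (k + 1)) = G k := by
    intro d
    induction d with
    | zero =>
      rintro m rfl _
      rw [← (hG' (m + 0 + 1)).1, add_zero, squeeze_proj, (hG' m).2]
    | succ d ih =>
      intro m hm hn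
      rw [← squeeze_succ_s, hG.2 m _ hn (by omega), ih (m + 1) (by omega) (by omega)]
  exact key (k - n) n (by omega) le_rfl

/-- `A` is obtained by setting `x n = 0` and renumbering the later variables, in which `G` is
symmetric, so `A` is symmetric from `x n` on. Setting `x n = 0` in `A` amounts to inserting two
zeros in `G`; one of them is absorbed by stability, so `A` and `G` agree at `x n = 0` and `G - A` is
divisible by `x n`. -/
theorem exists_eq_add_limX {L : Submodule K (ℕ → R)} (hL : IsDegreeClosed L) {G : ℕ → R} {n : ℕ}
    (hG : G ∈ PSym L (n + 1)) :
    ∃ A ∈ PSym L n, ∃ B ∈ PSym L (n + 1), G = A + limX n B := by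
  have hG₀ := hL.mem_PSym_iff.1 hG
  have hG' := mem_PInf_iff.1 (hL.le hG₀.1)
  have hf : Compatible n fun k => squeeze n (G (k + 1)) := fun k hk => by
    rw [proj_squeeze hk, proj_squeeze hk, (hG' (k + 1)).1, (hG' (k + 1)).2]
    exact ⟨rfl, rfl⟩
  set A := extend n fun k => squeeze n (G (k + 1)) with hA
  have hAL : A ∈ L := hL.extend_mem hG₀.1 hf 0 fun k _ => ⟨k + 1, totalDegree_squeeze_le _ _⟩
  have hAk : ∀ k, n ≤ k → A k = squeeze n (G (k + 1)) := fun k hk => extend_apply hf hk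
  have hAS : A ∈ PSym L n := hL.mem_PSym_iff.2 ⟨hAL, fun i k hi hk => by
    rw [hAk k (by omega), s_squeeze hi, hG₀.2 (i + 1) (k + 1) (by omega) (by omega)]⟩
  have hdvd : ∀ᶠ k in atTop, x n ∣ (G - A) k := by
    filter_upwards [eventually_gt_atTop n] with k hk
    rw [x_dvd_iff_kill, Pi.sub_apply, map_sub, hAk k hk.le, kill_squeeze,
      squeeze_of_mem_PSym hL hG hk, sub_self]
  obtain ⟨B, hB, hGB⟩ := hL.exists_limX_eq (L.sub_mem hG₀.1 hAL) hdvd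
  refine ⟨A, hAS, B, hL.mem_PSym_iff.2 ⟨hB, fun i k hi hk => ?_⟩, ?_⟩
  · refine mul_left_cancel₀ (x_ne_zero n) ?_
    have h₁ : x n * B k = G k - A k := by
      rw [← limX_apply B (by omega), ← hGB, Pi.sub_apply]
    rw [h₁, ← hG₀.2 i k hi hk, ← (hL.mem_PSym_iff.1 hAS).2 i k (by omega) hk, ← map_sub, ← h₁,
      map_mul, s_x_of_ne (by omega) (by omega)]
  · rw [← hGB, add_sub_cancel]

/-! ### The order of vanishing at `t = 0` -/

theorem prime_X_zero : Prime (MvPolynomial.X 0 : Pol) := MvPolynomial.X_prime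

theorem exists_eq_X_pow_mul {B : Pol} (hB : B ≠ 0) :
    ∃ (n : ℕ) (C : Pol), B = MvPolynomial.X 0 ^ n * C ∧ ¬ MvPolynomial.X 0 ∣ C :=
  ⟨_, (FiniteMultiplicity.of_prime_left prime_X_zero hB).exists_eq_pow_mul_and_not_dvd⟩

theorem algebraMap_X_zero : algebraMap Pol K (MvPolynomial.X 0) = t := rfl

theorem algebraMap_ne_zero {B : Pol} (hB : ¬ MvPolynomial.X 0 ∣ B) : algebraMap Pol K B ≠ 0 := by
  rw [Ne, FaithfulSMul.algebraMap_eq_zero_iff]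
  rintro rfl
  exact hB (dvd_zero _)

/-- Cancelling the powers of `t` in the denominator makes it prime to `t`; such fractions form a
ring, in which order at least `M` means divisibility by `t ^ M`. -/
theorem ordGE_iff {M : ℕ} {a : K} : OrdGE M a ↔ ∃ A B : Pol, ¬ MvPolynomial.X 0 ∣ B ∧
    a = t ^ M * (algebraMap Pol K A / algebraMap Pol K B) := by
  constructor
  · rintro ⟨A, B, hB, rfl, h⟩
    obtain ⟨n, C, rfl, hC⟩ := exists_eq_X_pow_mul hB
    have h₁ : (MvPolynomial.X 0 : Pol) ^ (M + n) ∣ A := by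
      refine pow_dvd_of_le_emultiplicity (le_trans ?_ h)
      push_cast
      gcongr
      exact le_emultiplicity_of_pow_dvd (dvd_mul_right _ _)
    obtain ⟨D, rfl⟩ := h₁
    refine ⟨D, C, hC, ?_⟩
    have := algebraMap_ne_zero hC
    have := t_ne_zero
    simp only [map_mul, map_pow, algebraMap_X_zero]
    field_simp
    ring
  · rintro ⟨A, B, hB, rfl⟩
    refine ⟨MvPolynomial.X 0 ^ M * A, B, fun h => hB (h ▸ dvd_zero _), ?_, ?_⟩
    · rw [map_mul, map_pow, algebraMap_X_zero, mul_div_assoc]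
    · rw [emultiplicity_eq_zero.2 hB, add_zero]
      exact le_emultiplicity_of_pow_dvd (dvd_mul_right _ _)

theorem OrdGE.add {M : ℕ} {a b : K} (ha : OrdGE M a) (hb : OrdGE M b) : OrdGE M (a + b) := by
  rw [ordGE_iff] at *
  obtain ⟨A, B, hB, rfl⟩ := ha
  obtain ⟨C, D, hD, rfl⟩ := hb
  refine ⟨A * D + C * B, B * D, prime_X_zero.not_dvd_mul hB hD, ?_⟩
  have := algebraMap_ne_zero hB
  have := algebraMap_ne_zero hD
  simp only [map_mul, map_add]
  field_simp

theorem ordGE_zero (M : ℕ) : OrdGE M 0 :=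
  ordGE_iff.2 ⟨0, 1, prime_X_zero.not_dvd_one, by simp⟩

theorem ordGE_t_pow {M n : ℕ} (h : M ≤ n) : OrdGE M (t ^ n) :=
  ordGE_iff.2 ⟨MvPolynomial.X 0 ^ (n - M), 1, prime_X_zero.not_dvd_one, by
    rw [map_pow, algebraMap_X_zero, map_one, div_one, ← pow_add, Nat.add_sub_cancel' h]⟩

/-- Here `r` is the order of the denominator of `c` at `t = 0`, a bound for its pole. -/
theorem exists_ordGE_mul (c : K) : ∃ r, ∀ M a, OrdGE (M + r) a → OrdGE M (c * a) := by
  obtain ⟨A, B, hB, rfl⟩ := IsFractionRing.div_surjective (A := Pol) c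
  obtain ⟨r, C, rfl, hC⟩ := exists_eq_X_pow_mul (nonZeroDivisors.ne_zero hB)
  refine ⟨r, fun M a ha => ?_⟩
  obtain ⟨D, E, hE, rfl⟩ := ordGE_iff.1 ha
  refine ordGE_iff.2 ⟨A * D, C * E, prime_X_zero.not_dvd_mul hC hE, ?_⟩
  have := algebraMap_ne_zero hC
  have := algebraMap_ne_zero hE
  have := t_ne_zero
  simp only [map_mul, map_pow, algebraMap_X_zero]
  field_simp
  ring

theorem eq_zero_of_forall_ordGE {a : K} (h : ∀ M, OrdGE M a) : a = 0 := by
  obtain ⟨A, B, hB, rfl⟩ := IsFractionRing.div_surjective (A := Pol) a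
  by_contra h₀
  have hA : A ≠ 0 := fun h => h₀ (by simp [h])
  obtain ⟨n, C, rfl, hC⟩ := exists_eq_X_pow_mul hA
  obtain ⟨D, E, hE, h₁⟩ := ordGE_iff.1 (h (n + 1))
  have hB' : algebraMap Pol K B ≠ 0 := by
    rw [Ne, FaithfulSMul.algebraMap_eq_zero_iff]; exact nonZeroDivisors.ne_zero hB
  have hE' := algebraMap_ne_zero hE
  rw [← mul_div_assoc, div_eq_div_iff hB' hE', ← algebraMap_X_zero, ← map_pow, ← map_mul, ← map_mul,
    ← map_mul] at h₁
  have h₂ := FaithfulSMul.algebraMap_injective Pol K h₁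
  rw [pow_succ, mul_assoc, mul_assoc, mul_assoc] at h₂
  have h₃ := mul_left_cancel₀ (pow_ne_zero n prime_X_zero.ne_zero) h₂
  exact prime_X_zero.not_dvd_mul hC hE ⟨_, h₃⟩

namespace ScalarTendsTo

theorem const (a : K) : ScalarTendsTo (fun _ => a) a := fun M => by
  simp [ordGE_zero]

theorem add {a b : ℕ → K} {α β : K} (ha : ScalarTendsTo a α) (hb : ScalarTendsTo b β) :
    ScalarTendsTo (fun k => a k + b k) (α + β) := fun M => by
  filter_upwards [ha M, hb M] with k h₁ h₂
  rw [add_sub_add_comm]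
  exact h₁.add h₂

theorem const_mul {a : ℕ → K} {α : K} (ha : ScalarTendsTo a α) (c : K) :
    ScalarTendsTo (fun k => c * a k) (c * α) := fun M => by
  obtain ⟨r, hr⟩ := exists_ordGE_mul c
  filter_upwards [ha (M + r)] with k h
  rw [← mul_sub]
  exact hr _ _ h

theorem sum {N : ℕ} {a : Fin N → ℕ → K} {α : Fin N → K} (h : ∀ j, ScalarTendsTo (a j) (α j)) :
    ScalarTendsTo (fun k => ∑ j, a j k) (∑ j, α j) := by
  induction N with
  | zero => simpa using const 0
  | succ N ih =>
    simp only [Fin.sum_univ_succ]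
    exact (h 0).add (ih fun j => h j.succ)

theorem congr {a b : ℕ → K} {α : K} (ha : ScalarTendsTo a α) (h : ∀ᶠ k in atTop, a k = b k) :
    ScalarTendsTo b α := fun M => by
  filter_upwards [ha M, h] with k h₁ h₂
  rwa [← h₂]

theorem unique {a : ℕ → K} {α β : K} (ha : ScalarTendsTo a α) (hb : ScalarTendsTo a β) :
    α = β := by
  have h := ha.add (hb.const_mul (-1))
  refine sub_eq_zero.1 (eq_zero_of_forall_ordGE fun M => ?_)
  -- The zero sequence tends to `α - β`. The extra factor `-1` gives the error term the sign of `α -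
  -- β`.
  obtain ⟨k, hk⟩ := (((h.const_mul (-1)) M).exists)
  convert hk using 1
  ring

theorem t_pow : ScalarTendsTo (fun k => t ^ k) 0 := fun M => by
  filter_upwards [eventually_ge_atTop M] with k hk
  rw [sub_zero]
  exact ordGE_t_pow hk

end ScalarTendsTo

/-! ### Coefficientwise convergence -/

theorem proj_monomial (k : ℕ) (m : ℕ →₀ ℕ) (a : K) :
    proj k (MvPolynomial.monomial m a) =
      if ∀ j ∈ m.support, j < k then MvPolynomial.monomial m a else 0 := by
  rw [proj, MvPolynomial.aeval_monomial]
  split_ifs with h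
  · rw [MvPolynomial.monomial_eq]
    congr 1
    refine Finset.prod_congr rfl fun j hj => ?_
    simp only [if_pos (h j hj)]
    rfl
  · push Not at h
    obtain ⟨j, hj, hk⟩ := h
    rw [Finsupp.prod, Finset.prod_eq_zero hj, mul_zero]
    rw [if_neg (by omega), zero_pow (Finsupp.mem_support_iff.1 hj)]

theorem coeff_proj (k : ℕ) (m : ℕ →₀ ℕ) (f : R) :
    (proj k f).coeff m = if ∀ j ∈ m.support, j < k then f.coeff m else 0 := by
  induction f using MvPolynomial.induction_on' with
  | monomial n a =>
    rw [proj_monomial]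
    rcases eq_or_ne n m with rfl | h
    · split_ifs <;> simp
    · have h₀ : (MvPolynomial.monomial n a : R).coeff m = 0 := by
        rw [MvPolynomial.coeff_monomial, if_neg h]
      split_ifs <;> simp [h₀]
  | add p r hp hr =>
    rw [map_add, MvPolynomial.coeff_add, hp, hr, MvPolynomial.coeff_add]
    split_ifs <;> simp

/-- The coefficient of a monomial in an element of the inverse limit. -/
def limCoeff (m : ℕ →₀ ℕ) : (ℕ → R) →ₗ[K] K where
  toFun F := (F (m.support.sup id + 1)).coeff m
  map_add' F G := by simp
  map_smul' c F := by simp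

theorem limCoeff_eq {F : ℕ → R} (hF : F ∈ PInf) {m : ℕ →₀ ℕ} {k : ℕ}
    (hk : m.support.sup id + 1 ≤ k) : (F k).coeff m = limCoeff m F := by
  change _ = (F (m.support.sup id + 1)).coeff m
  rw [← proj_of_mem_PInf hF hk, coeff_proj, if_pos]
  intro j hj
  exact Nat.lt_succ_of_le (Finset.le_sup (f := id) hj)

theorem PInf_ext_coeff {F G : ℕ → R} (hF : F ∈ PInf) (hG : G ∈ PInf)
    (h : ∀ m, limCoeff m F = limCoeff m G) : F = G := by
  funext k
  ext m
  rw [← proj_of_mem_PInf hF (le_max_left k (m.support.sup id + 1)),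
    ← proj_of_mem_PInf hG (le_max_left k (m.support.sup id + 1)), coeff_proj, coeff_proj,
    limCoeff_eq hF (le_max_right _ _), limCoeff_eq hG (le_max_right _ _), h]

/-- Coefficients of elements of the inverse limit are eventually constant in `k`, so only the
scalars `a j k` vary. This yields uniqueness of limits although the data in `ConvergesTo` are not
unique. -/
theorem ConvergesTo.coeff {L : Submodule K (ℕ → R)} (hL : IsDegreeClosed L) {f F : ℕ → R}
    (h : ConvergesTo L f F) (m : ℕ →₀ ℕ) :
    ScalarTendsTo (fun k => (f k).coeff m) (limCoeff m F) := by
  obtain ⟨N, h, g, a, b, hh, hg, hab, hf, rfl⟩ := h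
  have hg' : ∀ j, g j ∈ PInf := fun j => hL.le (hg j).choose_spec.1
  have h₁ : ScalarTendsTo (fun k => limCoeff m h + ∑ j, limCoeff m (g j) * a j k)
      (limCoeff m h + ∑ j, limCoeff m (g j) * b j) :=
    (ScalarTendsTo.const _).add (ScalarTendsTo.sum fun j => (hab j).const_mul _)
  have h₂ : limCoeff m (h + ∑ j, b j • g j) = limCoeff m h + ∑ j, limCoeff m (g j) * b j := by
    simp [mul_comm]
  rw [h₂]
  refine h₁.congr ?_
  filter_upwards [hf, eventually_ge_atTop (m.support.sup id + 1)] with k hk hm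
  rw [hk, MvPolynomial.coeff_add, MvPolynomial.coeff_sum, limCoeff_eq (hL.le hh) hm]
  congr 1
  refine Finset.sum_congr rfl fun j _ => ?_
  rw [MvPolynomial.coeff_smul, limCoeff_eq (hg' j) hm, smul_eq_mul, mul_comm]

/-! ### Existence of the limit of the first Cherednik operator -/

/-- `T_0 T_1 ⋯ T_{n-1}`. -/
def TUp : ℕ → (R →ₗ[K] R)
  | 0 => LinearMap.id
  | n + 1 => TUp n ∘ₗ T n

theorem TinvChain_TUp_self (n : ℕ) (f : R) : TinvChain n (TUp n f) = f := by
  induction n generalizing f with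
  | zero => rfl
  | succ n ih =>
    change Tinv n (TinvChain n (TUp n (T n f))) = f
    rw [ih, Tinv_T]

theorem TinvChain_TUp {n m : ℕ} (h : n ≤ m) {f : R}
    (hf : ∀ i, n ≤ i → i < m → T i f = f) : TinvChain m (TUp n f) = f := by
  induction m, h using Nat.le_induction with
  | base => exact TinvChain_TUp_self n f
  | succ m h ih =>
    rw [TinvChain_succ, ih fun i h₁ h₂ => hf i h₁ (by omega)]
    exact ((T_eq_iff m f f).1 (hf m h (by omega))).symm

variable {L : Submodule K (ℕ → R)}

/-- By `cherednik_x_zero` the operator on multiples of `x 0` involves `k` only through `cyc k` and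
`TChain (k - 1)`, and `proj_cyc_T` makes the results compatible. No limit process is needed here. -/
theorem exists_Ytilde_zero_limX (hL : IsDegreeClosed L) {G : ℕ → R} (hG : G ∈ L) :
    ∃ H ∈ L, ∀ k, 0 < k → Ytilde k 0 (limX 0 G k) = H k := by
  have hG' := mem_PInf_iff.1 (hL.le hG)
  have hf : Compatible 1 fun k => (t * q) • (x 0 * cyc k (TChain (k - 1) (G k))) := by
    intro k hk
    obtain ⟨m, rfl⟩ : ∃ m, k = m + 1 := ⟨k - 1, by omega⟩
    have h₀ : proj (m + 1) (x 0) = x 0 := by rw [proj_x, if_pos (by omega)]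
    simp only [map_smul, map_mul, h₀, Nat.add_sub_cancel]
    constructor
    · rw [proj_cyc, proj_TChain le_rfl, (hG' (m + 1)).1]
    · rw [TChain_succ, proj_cyc_T, proj_TChain le_rfl, (hG' (m + 1)).2]
  refine ⟨_, hL.extend_mem hG hf 1 fun k _ => ⟨k, ?_⟩, fun k hk => ?_⟩
  · refine (MvPolynomial.totalDegree_smul_le _ _).trans ((totalDegree_x_mul_le _ _).trans ?_)
    exact Nat.add_le_add_right ((totalDegree_cyc_le _ _).trans (totalDegree_TChain_le _ _)) 1
  · rw [extend_apply hf hk]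
    obtain ⟨m, rfl⟩ : ∃ m, k = m + 1 := ⟨k - 1, by omega⟩
    rw [limX_apply _ hk, Ytilde_zero_of_dvd (dvd_mul_right _ _), cherednik_x_zero,
      Nat.add_sub_cancel]

theorem PSym_mono {n m : ℕ} (h : n ≤ m) : PSym L n ≤ PSym L m :=
  fun _ hF => ⟨hF.1, fun i hi => hF.2 i (h.trans hi)⟩

theorem exists_varpi_eq (hL : IsDegreeClosed L) {n : ℕ} {A : ℕ → R} (hA : A ∈ PSym L n) :
    ∃ E ∈ PSym L (n + 1), ∀ k, n < k → pr1 (cyc k (A k)) = E k := by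
  have hA₀ := hL.mem_PSym_iff.1 hA
  have hA' := mem_PInf_iff.1 (hL.le hA₀.1)
  have hf : Compatible (n + 1) fun k => pr1 (cyc k (A k)) := by
    intro k hk
    obtain ⟨m, rfl⟩ : ∃ m, k = m + 1 := ⟨k - 1, by omega⟩
    refine ⟨?_, ?_⟩
    · rw [← pr1_proj, proj_cyc, (hA' (m + 1)).1]
    -- Symmetry allows `s m` to be inserted, so that the variable sent to `q x 0` is one that
    -- survives the projection.
    · rw [← pr1_proj, ← hA₀.2 m (m + 1 + 1) (by omega) le_rfl, proj_cyc_s, (hA' (m + 1)).2]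
  have hE : extend (n + 1) (fun k => pr1 (cyc k (A k))) ∈ L :=
    hL.extend_mem hA₀.1 hf 0 fun k _ =>
      ⟨k, (totalDegree_pr1_le _).trans (totalDegree_cyc_le _ _)⟩
  refine ⟨_, ⟨hE, fun i hi => ?_⟩, fun k hk => (extend_apply hf hk).symm⟩
  refine PInf_ext (hL.le (hL.limT_mem hE i)) (hL.le hE) ?_
  filter_upwards [eventually_ge_atTop (i + n + 3)] with k hk
  rw [limT_apply (hL.le hE) (by omega), extend_apply hf (by omega)]
  obtain ⟨j, rfl⟩ : ∃ j, i = j + 1 := ⟨i - 1, by omega⟩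
  rw [← pr1_T (by omega), ← cyc_T (by omega),
    (T_eq_self_iff _ _).2 (hA₀.2 j k (by omega) (by omega))]

theorem limT_comm (hL : IsDegreeClosed L) {F : ℕ → R} (hF : F ∈ L) {i j : ℕ}
    (h : i + 1 < j ∨ j + 1 < i) : limT i (limT j F) = limT j (limT i F) := by
  have hi := hL.limT_mem hF i
  have hj := hL.limT_mem hF j
  refine PInf_ext (hL.le (hL.limT_mem hj i)) (hL.le (hL.limT_mem hi j)) ?_
  filter_upwards [eventually_ge_atTop (i + j + 2)] with k hk
  rw [limT_apply (hL.le hj) (by omega), limT_apply (hL.le hF) (by omega),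
    limT_apply (hL.le hi) (by omega), limT_apply (hL.le hF) (by omega), T_comm h]

theorem limT_limX_of_ne (hL : IsDegreeClosed L) {F : ℕ → R} (hF : F ∈ L) {i j : ℕ}
    (h₁ : j ≠ i) (h₂ : j ≠ i + 1) : limT i (limX j F) = limX j (limT i F) := by
  have hi := hL.limT_mem hF i
  have hj := hL.limX_mem hF j
  refine PInf_ext (hL.le (hL.limT_mem hj i)) (hL.le (hL.limX_mem hi j)) ?_
  filter_upwards [eventually_ge_atTop (i + j + 2)] with k hk
  rw [limT_apply (hL.le hj) (by omega), limX_apply _ (by omega), limX_apply _ (by omega),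
    limT_apply (hL.le hF) (by omega), T_x_of_ne h₁ h₂]

theorem limT_mem_PSym (hL : IsDegreeClosed L) {F : ℕ → R} {n : ℕ} (hF : F ∈ PSym L n) {i : ℕ}
    (hi : i + 2 ≤ n) : limT i F ∈ PSym L n :=
  ⟨hL.limT_mem hF.1 i, fun j hj => by rw [limT_comm hL hF.1 (by omega), hF.2 j hj]⟩

theorem limX_mem_PSym (hL : IsDegreeClosed L) {F : ℕ → R} {n : ℕ} (hF : F ∈ PSym L n) {i : ℕ}
    (hi : i + 1 ≤ n) : limX i F ∈ PSym L n :=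
  ⟨hL.limX_mem hF.1 i, fun j hj => by
    rw [limT_limX_of_ne hL hF.1 (by omega) (by omega), hF.2 j hj]⟩

theorem mem_PSym_of_Ytilde_zero_eq (hL : IsDegreeClosed L) {F H : ℕ → R} {n : ℕ}
    (hF : F ∈ PSym L n) (hH : H ∈ L) (hn : 0 < n)
    (h : ∀ᶠ k in atTop, Ytilde k 0 (F k) = H k) : H ∈ PSym L n := by
  refine ⟨hH, fun i hi => PInf_ext (hL.le (hL.limT_mem hH i)) (hL.le hH) ?_⟩
  filter_upwards [h, eventually_ge_atTop (i + 2)] with k hk hi'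
  rw [limT_apply (hL.le hH) hi', ← hk, ← Ytilde_zero_T (by omega) (by omega),
    ← limT_apply (hL.le hF.1) hi', hF.2 i hi]

/-! ### The operators on the almost symmetric module -/

/-- `𝒯_i` on the almost symmetric module. -/
def opT (hL : IsDegreeClosed L) (i : ℕ) : Module.End K (PAs L) :=
  (limT i).restrict (p := PAs L) (q := PAs L) fun _ ⟨n, hF⟩ =>
    ⟨max n (i + 2), limT_mem_PSym hL (PSym_mono (le_max_left _ _) hF) (le_max_right _ _)⟩

/-- `𝒳_i` on the almost symmetric module. -/
def opX (hL : IsDegreeClosed L) (i : ℕ) : Module.End K (PAs L) :=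
  (limX i).restrict (p := PAs L) (q := PAs L) fun _ ⟨n, hF⟩ =>
    ⟨max n (i + 1), limX_mem_PSym hL (PSym_mono (le_max_left _ _) hF) (le_max_right _ _)⟩

theorem PAs_le_PInf (hL : IsDegreeClosed L) (F : PAs L) : (F : ℕ → R) ∈ PInf :=
  hL.le F.2.choose_spec.1

theorem PAs_ext (hL : IsDegreeClosed L) {F G : PAs L}
    (h : ∀ᶠ k in atTop, (F : ℕ → R) k = (G : ℕ → R) k) : F = G :=
  Subtype.ext (PInf_ext (PAs_le_PInf hL F) (PAs_le_PInf hL G) h)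

theorem coe_opT (hL : IsDegreeClosed L) (i : ℕ) (F : PAs L) :
    (opT hL i F : ℕ → R) = limT i F := rfl

theorem coe_opX (hL : IsDegreeClosed L) (i : ℕ) (F : PAs L) :
    (opX hL i F : ℕ → R) = limX i F := rfl

theorem opT_apply (hL : IsDegreeClosed L) {i k : ℕ} (h : i + 2 ≤ k) (F : PAs L) :
    (opT hL i F : ℕ → R) k = T i ((F : ℕ → R) k) :=
  limT_apply (PAs_le_PInf hL F) h

theorem opX_apply (hL : IsDegreeClosed L) {i k : ℕ} (h : i < k) (F : PAs L) :
    (opX hL i F : ℕ → R) k = x i * (F : ℕ → R) k :=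
  limX_apply _ h

theorem opT_comm (hL : IsDegreeClosed L) {i j : ℕ} (h : i + 1 < j ∨ j + 1 < i) :
    opT hL i * opT hL j = opT hL j * opT hL i :=
  LinearMap.ext fun F => Subtype.ext (limT_comm hL F.2.choose_spec.1 h)

theorem opT_braid (hL : IsDegreeClosed L) (i : ℕ) :
    opT hL i * opT hL (i + 1) * opT hL i = opT hL (i + 1) * opT hL i * opT hL (i + 1) := by
  refine LinearMap.ext fun F => PAs_ext hL ?_
  filter_upwards [eventually_ge_atTop (i + 3)] with k hk
  simp only [Module.End.mul_apply]
  repeat rw [opT_apply hL (by omega)]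
  rw [T_braid]

theorem opT_mul_self (hL : IsDegreeClosed L) (i : ℕ) :
    opT hL i * opT hL i = (1 - t) • opT hL i + t • (1 : Module.End K (PAs L)) := by
  refine LinearMap.ext fun F => PAs_ext hL ?_
  filter_upwards [eventually_ge_atTop (i + 2)] with k hk
  simp only [Module.End.mul_apply, LinearMap.add_apply, LinearMap.smul_apply, Module.End.one_apply,
    Submodule.coe_add, Submodule.coe_smul, Pi.add_apply, Pi.smul_apply]
  repeat rw [opT_apply hL (by omega)]
  rw [T_T]

theorem opT_opX_opT (hL : IsDegreeClosed L) (i : ℕ) :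
    opT hL i * opX hL (i + 1) * opT hL i = t • opX hL i := by
  refine LinearMap.ext fun F => PAs_ext hL ?_
  filter_upwards [eventually_ge_atTop (i + 2)] with k hk
  simp only [Module.End.mul_apply, LinearMap.smul_apply, Submodule.coe_smul, Pi.smul_apply]
  rw [opT_apply hL (by omega), opX_apply hL (by omega), opT_apply hL (by omega),
    opX_apply hL (by omega), T_x_right_eq_Tinv, Tinv_T]

theorem opT_opX (hL : IsDegreeClosed L) {i j : ℕ} (h₁ : j ≠ i) (h₂ : j ≠ i + 1) :
    opT hL i * opX hL j = opX hL j * opT hL i :=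
  LinearMap.ext fun F => Subtype.ext (limT_limX_of_ne hL F.2.choose_spec.1 h₁ h₂)

theorem opX_comm (hL : IsDegreeClosed L) (i j : ℕ) :
    opX hL i * opX hL j = opX hL j * opX hL i := by
  refine LinearMap.ext fun F => Subtype.ext (funext fun k => ?_)
  exact mul_left_comm (proj k (x i)) (proj k (x j)) _

/-! ### Consequences of the Hecke relations -/

/-- The braid and quadratic relations. -/
structure IsHecke {A : Type*} [Ring A] [Algebra K A] (T : ℕ → A) : Prop where
  comm : ∀ {i j : ℕ}, i + 1 < j ∨ j + 1 < i → T i * T j = T j * T i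
  braid : ∀ i : ℕ, T i * T (i + 1) * T i = T (i + 1) * T i * T (i + 1)
  mul_self : ∀ i : ℕ, T i * T i = (1 - t) • T i + t • (1 : A)

section Ring

variable {A : Type*} [Ring A] [Algebra K A] {T : ℕ → A} {y : A}

/-- The inverse of `T_i`. -/
def heckeInv (T : ℕ → A) (i : ℕ) : A := t⁻¹ • (T i + (t - 1) • (1 : A))

/-- The elements `y_0 = y`, `y_{i+1} = t⁻¹ T_i y_i T_i`. -/
def jucys (T : ℕ → A) (y : A) : ℕ → A
  | 0 => y
  | i + 1 => t⁻¹ • (T i * jucys T y i * T i)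

theorem jucys_succ (T : ℕ → A) (y : A) (i : ℕ) :
    jucys T y (i + 1) = t⁻¹ • (T i * jucys T y i * T i) := rfl

theorem IsHecke.mul_inv (hT : IsHecke T) (i : ℕ) : T i * heckeInv T i = 1 := by
  rw [heckeInv, mul_smul_comm, mul_add, hT.mul_self, mul_smul_comm, mul_one,
    show (1 - t) • T i + t • (1 : A) + (t - 1) • T i = t • (1 : A) by
      rw [add_right_comm, ← add_smul]; simp, smul_smul, inv_mul_cancel₀ t_ne_zero, one_smul]

theorem IsHecke.inv_mul (hT : IsHecke T) (i : ℕ) : heckeInv T i * T i = 1 := by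
  rw [← hT.mul_inv i, heckeInv, smul_mul_assoc, mul_smul_comm, add_mul, mul_add, smul_mul_assoc,
    mul_smul_comm, one_mul, mul_one]

theorem braid_conj {A : Type*} [Ring A] {a b z : A} (hab : a * b * a = b * a * b) (hz : z * b = b * z) :
    a * z * a * (b * (a * z * a) * b) = a * b * (z * (a * z * a)) * (b * a) := by
  calc a * z * a * (b * (a * z * a) * b) = a * z * (a * b * a) * z * a * b := by
        simp only [mul_assoc]
    _ = a * (z * b) * a * (b * z) * a * b := by rw [hab]; simp only [mul_assoc]
    _ = a * (b * z) * a * (z * b) * a * b := by rw [hz]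
    _ = a * b * z * a * z * (b * a * b) := by simp only [mul_assoc]
    _ = _ := by rw [← hab]; simp only [mul_assoc]

theorem braid_conj' {A : Type*} [Ring A] {a b z : A} (hab : a * b * a = b * a * b) (hz : z * b = b * z) :
    b * (a * z * a) * b * (a * z * a) = a * b * (a * z * a * z) * (b * a) := by
  calc b * (a * z * a) * b * (a * z * a) = b * a * z * (a * b * a) * z * a := by
        simp only [mul_assoc]
    _ = b * a * (z * b) * a * (b * z) * a := by rw [hab]; simp only [mul_assoc]
    _ = b * a * (b * z) * a * (z * b) * a := by rw [hz]
    _ = (b * a * b) * z * a * z * b * a := by simp only [mul_assoc]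
    _ = _ := by rw [← hab]; simp only [mul_assoc]

theorem braid_comm {A : Type*} [Ring A] {a b z : A} (hab : a * b * a = b * a * b) (hz : z * b = b * z) :
    a * (b * (a * z * a) * b) = b * (a * z * a) * b * a := by
  calc a * (b * (a * z * a) * b) = (a * b * a) * z * a * b := by simp only [mul_assoc]
    _ = b * a * (b * z) * a * b := by rw [hab]; simp only [mul_assoc]
    _ = b * a * z * (b * a * b) := by rw [← hz]; simp only [mul_assoc]
    _ = _ := by rw [← hab]; simp only [mul_assoc]

theorem IsHecke.T_jucys_of_lt (hT : IsHecke T) (hy : ∀ i, 0 < i → T i * y = y * T i) {i j : ℕ}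
    (h : j < i) : T i * jucys T y j = jucys T y j * T i := by
  induction j with
  | zero => exact hy i h
  | succ j ih =>
    have h₁ : T i * T j = T j * T i := hT.comm (by omega)
    have h₂ := ih (by omega)
    rw [jucys_succ, mul_smul_comm, smul_mul_assoc, ← mul_assoc, ← mul_assoc, h₁, mul_assoc (T j),
      h₂, ← mul_assoc, mul_assoc _ (T i), h₁, ← mul_assoc]

theorem IsHecke.T_jucys_of_gt (hT : IsHecke T) (hy : ∀ i, 0 < i → T i * y = y * T i) {i j : ℕ}
    (h : i + 2 ≤ j) : T i * jucys T y j = jucys T y j * T i := by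
  induction j, h using Nat.le_induction with
  | base =>
    rw [jucys_succ, jucys_succ]
    simp only [mul_smul_comm, smul_mul_assoc]
    rw [braid_comm (hT.braid i) (hT.T_jucys_of_lt hy (Nat.lt_succ_self i)).symm]
  | succ j h ih =>
    have h₁ : T i * T j = T j * T i := hT.comm (by omega)
    rw [jucys_succ, mul_smul_comm, smul_mul_assoc, ← mul_assoc, ← mul_assoc, h₁, mul_assoc (T j),
      ih, ← mul_assoc, mul_assoc _ (T i), h₁, ← mul_assoc]

theorem IsHecke.T_jucys (hT : IsHecke T) (hy : ∀ i, 0 < i → T i * y = y * T i) {i j : ℕ}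
    (h₁ : j ≠ i) (h₂ : j ≠ i + 1) : T i * jucys T y j = jucys T y j * T i := by
  rcases Nat.lt_or_ge j i with h | h
  · exact hT.T_jucys_of_lt hy h
  · exact hT.T_jucys_of_gt hy (by omega)

/-- The commutator of `y_i` and `y_{i+1}`. -/
def jucysComm (T : ℕ → A) (y : A) (i : ℕ) : A :=
  jucys T y i * jucys T y (i + 1) - jucys T y (i + 1) * jucys T y i

/-- Both products of `y_{i+1}` and `y_{i+2}` are the corresponding products of `y_i` and `y_{i+1}`,
multiplied by `T_i T_{i+1}` on the left and `T_{i+1} T_i` on the right, by the braid relation and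
`T_{i+1} y_i = y_i T_{i+1}`. -/
theorem IsHecke.jucysComm_succ (hT : IsHecke T) (hy : ∀ i, 0 < i → T i * y = y * T i) (i : ℕ) :
    jucysComm T y (i + 1) =
      (t⁻¹ * t⁻¹) • (T i * T (i + 1) * jucysComm T y i * (T (i + 1) * T i)) := by
  have hz := (hT.T_jucys_of_lt hy (Nat.lt_succ_self i)).symm
  have h₁ := braid_conj (hT.braid i) hz
  have h₂ := braid_conj' (hT.braid i) hz
  rw [jucysComm, jucysComm, jucys_succ T y (i + 1), jucys_succ T y i]
  simp only [mul_smul_comm, smul_mul_assoc, mul_sub, sub_mul, smul_sub, h₁, h₂, smul_smul, mul_assoc t⁻¹]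

theorem smul_identity {F M : Type*} [Field F] [AddCommGroup M] [Module F M] (c : F)
    (u v w n : M) :
    (1 - c) • u + c • w - n + (c - 1) • (u - v) = -(n - ((1 - c) • v + c • w)) := by
  module

/-- With `z = y_i` and `a = T_i`, the quadratic relation produces the same term `t • (z * a * z)` in
`z a z a a` and in `a a z a z`, and it cancels. Consequently the kernel of the commutator is stable
under `T_i⁻¹`. -/
theorem IsHecke.jucysComm_mul_inv (hT : IsHecke T) (y : A) (i : ℕ) :
    jucysComm T y i * heckeInv T i = -(t⁻¹ • (T i * jucysComm T y i)) := by
  have h := hT.mul_self i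
  set a := T i with ha
  set z := jucys T y i with hz
  have h₁ : jucysComm T y i = t⁻¹ • (z * (a * z * a) - a * z * a * z) := by
    rw [jucysComm, jucys_succ, mul_smul_comm, smul_mul_assoc, smul_sub]
  have e₁ : z * (a * z * a) * a = (1 - t) • (z * (a * z * a)) + t • (z * a * z) := by
    rw [show z * (a * z * a) * a = z * a * z * (a * a) by simp only [mul_assoc], h, mul_add,
      mul_smul_comm, mul_smul_comm, mul_one]
    simp only [mul_assoc]
  have e₂ : a * (a * z * a * z) = (1 - t) • (a * z * a * z) + t • (z * a * z) := by
    rw [show a * (a * z * a * z) = a * a * (z * a * z) by simp only [mul_assoc], h, add_mul,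
      smul_mul_assoc, smul_mul_assoc, one_mul]
    simp only [mul_assoc]
  have e₃ : a * z * a * z * a = a * (z * (a * z * a)) := by simp only [mul_assoc]
  have e₄ : (z * (a * z * a) - a * z * a * z) * (a + (t - 1) • (1 : A)) =
      -(a * (z * (a * z * a) - a * z * a * z)) := by
    rw [mul_add, sub_mul, e₁, e₃, mul_sub, e₂, mul_smul_comm, mul_one]
    exact smul_identity t _ _ _ _
  rw [h₁, heckeInv, ← ha, smul_mul_assoc, mul_smul_comm, e₄, mul_smul_comm, smul_neg, smul_neg]

/-- `y` commutes with `y_1` by assumption and with later `y_j` because it commutes with `T_j`, `j ≥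
1`. For `i < j` one then inducts on `i`, as `T_i` commutes with `y_j` once `j ≥ i + 2`. -/
theorem IsHecke.jucys_comm (hT : IsHecke T) (hy : ∀ i, 0 < i → T i * y = y * T i)
    (h₀ : y * jucys T y 1 = jucys T y 1 * y) (i j : ℕ) :
    jucys T y i * jucys T y j = jucys T y j * jucys T y i := by
  have hz : ∀ j, y * jucys T y j = jucys T y j * y := by
    intro j
    induction j with
    | zero => rfl
    | succ j ih =>
      rcases Nat.eq_zero_or_pos j with rfl | hj
      · exact h₀
      · rw [jucys_succ, mul_smul_comm, smul_mul_assoc, ← mul_assoc, ← mul_assoc, ← hy j hj,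
          mul_assoc (T j), ih, ← mul_assoc, mul_assoc _ y, ← hy j hj, ← mul_assoc]
  have key : ∀ i j, i ≤ j → jucys T y i * jucys T y j = jucys T y j * jucys T y i := by
    intro i
    induction i with
    | zero => exact fun j _ => hz j
    | succ i ih =>
      intro j hj
      rcases hj.eq_or_lt with rfl | hj
      · rfl
      · have h₁ := hT.T_jucys_of_gt hy (i := i) (j := j) (by omega)
        have h₂ := ih j (by omega)
        rw [jucys_succ, smul_mul_assoc, mul_smul_comm, mul_assoc, h₁, ← mul_assoc, mul_assoc (T i),
          h₂, ← mul_assoc, h₁]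
        simp only [mul_assoc]
  rcases le_total i j with h | h
  · exact key i j h
  · exact (key j i h).symm

/-- `T_0 T_1 ⋯ T_{n-1}`. -/
def upProd (T : ℕ → A) : ℕ → A
  | 0 => 1
  | n + 1 => upProd T n * T n

theorem exists_jucys_eq (T : ℕ → A) (y : A) (n : ℕ) :
    ∃ d, jucys T y n = d * y * upProd T n := by
  induction n with
  | zero => exact ⟨1, by simp [jucys, upProd]⟩
  | succ n ih =>
    obtain ⟨d, hd⟩ := ih
    refine ⟨t⁻¹ • (T n * d), ?_⟩
    rw [jucys_succ, hd, upProd]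
    simp only [smul_mul_assoc, mul_assoc]

end Ring

/-! ### Commutation on an almost symmetric module -/

section Module

variable {V : Type*} [AddCommGroup V] [Module K V] {T X : ℕ → Module.End K V}
  {y : Module.End K V}

/-- The vectors fixed by `T_i` for all `i ≥ n`. -/
def IsFixed (T : ℕ → Module.End K V) (n : ℕ) (v : V) : Prop := ∀ i, n ≤ i → T i v = v

theorem IsFixed.mono {n m : ℕ} {v : V} (hv : IsFixed T n v) (h : n ≤ m) : IsFixed T m v :=
  fun i hi => hv i (h.trans hi)

theorem IsFixed.apply {n : ℕ} {v : V} (hv : IsFixed T n v) {f : Module.End K V}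
    (hf : ∀ i, n ≤ i → T i * f = f * T i) : IsFixed T n (f v) := fun i hi => by
  rw [← Module.End.mul_apply, hf i hi, Module.End.mul_apply, hv i hi]

theorem IsFixed.heckeInv (hT : IsHecke T) {n i : ℕ} {v : V} (hv : IsFixed T n v)
    (hi : i + 2 ≤ n) : IsFixed T n (heckeInv T i v) :=
  hv.apply fun j hj => by
    rw [StableDAHA.heckeInv, mul_smul_comm, smul_mul_assoc, mul_add, add_mul,
      hT.comm (by omega), mul_smul_comm, smul_mul_assoc, one_mul, mul_one]

theorem IsHecke.apply_inv (hT : IsHecke T) (i : ℕ) (v : V) : T i (heckeInv T i v) = v := by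
  rw [← Module.End.mul_apply, hT.mul_inv, Module.End.one_apply]

theorem IsHecke.eq_zero_of_apply (hT : IsHecke T) {i : ℕ} {v : V} (h : T i v = 0) : v = 0 := by
  rw [← Module.End.one_apply (R := K) v, ← hT.inv_mul i, Module.End.mul_apply, h, map_zero]

/-- The relations between the operators `T_i` and `X_i`, and the decomposition of vectors fixed by
almost all `T_i`. -/
structure IsAlmostSymmetric (T X : ℕ → Module.End K V) : Prop where
  hecke : IsHecke T
  T_X_T : ∀ i, T i * X (i + 1) * T i = t • X i
  T_X : ∀ {i j}, j ≠ i → j ≠ i + 1 → T i * X j = X j * T i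
  exists_isFixed : ∀ v, ∃ n, IsFixed T n v
  exists_eq_add : ∀ {n v}, IsFixed T (n + 1) v →
    ∃ a b, IsFixed T n a ∧ IsFixed T (n + 1) b ∧ v = a + X n b

/-- The conjugation that takes `C_i` to `C_{i+1}` matches `T_{i+1} T_i X_{i+1} X_{i+2} T_i T_{i+1} =
t² X_i X_{i+1}`. -/
theorem IsAlmostSymmetric.jucysComm_X_X (h : IsAlmostSymmetric T X)
    (hy : ∀ i, 0 < i → T i * y = y * T i) (h₀ : ∀ v, jucysComm T y 0 (X 0 (X 1 v)) = 0)
    (i : ℕ) (v : V) : jucysComm T y i (X i (X (i + 1) v)) = 0 := by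
  induction i generalizing v with
  | zero => exact h₀ v
  | succ i ih =>
    obtain ⟨w, rfl⟩ : ∃ w, v = T i (T (i + 1) w) :=
      ⟨_, by rw [h.hecke.apply_inv (i + 1), h.hecke.apply_inv i v]⟩
    have e : T (i + 1) * T i * (X (i + 1) * X (i + 1 + 1) * (T i * T (i + 1))) =
        (t * t) • (X i * X (i + 1)) := by
      calc T (i + 1) * T i * (X (i + 1) * X (i + 1 + 1) * (T i * T (i + 1)))
          = T (i + 1) * T i * X (i + 1) * (X (i + 1 + 1) * T i) * T (i + 1) := by
            simp only [mul_assoc]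
        _ = T (i + 1) * (T i * X (i + 1) * T i) * X (i + 1 + 1) * T (i + 1) := by
            rw [← h.T_X (i := i) (j := i + 1 + 1) (by omega) (by omega)]
            simp only [mul_assoc]
        _ = t • ((T (i + 1) * X i) * X (i + 1 + 1) * T (i + 1)) := by
            rw [h.T_X_T, mul_smul_comm, smul_mul_assoc, smul_mul_assoc]
        _ = t • (X i * (T (i + 1) * X (i + 1 + 1) * T (i + 1))) := by
            rw [h.T_X (i := i + 1) (j := i) (by omega) (by omega)]
            simp only [mul_assoc]
        _ = _ := by rw [h.T_X_T, mul_smul_comm, smul_smul]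
    have e' := LinearMap.congr_fun e w
    simp only [Module.End.mul_apply, LinearMap.smul_apply] at e'
    rw [h.hecke.jucysComm_succ hy]
    simp only [LinearMap.smul_apply, Module.End.mul_apply]
    rw [e', map_smul, ih, smul_zero, map_zero, map_zero, smul_zero]

/-- Vectors of level `n + 1` are killed by `y_{n+1}`, and `y_n` preserves that level, so the
commutator kills them. A vector of level `n + 2` differs from one of these by `X_{n+1} b = t T_n⁻¹
X_n T_n⁻¹ b`. The outer `T_n⁻¹` is harmless, and splitting `T_n⁻¹ b = c + X_{n+1} d` leaves `X_n c`,
of level `n + 1`, and `X_n X_{n+1} d`. -/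
theorem IsAlmostSymmetric.jucysComm_of_isFixed (h : IsAlmostSymmetric T X)
    (hy : ∀ i, 0 < i → T i * y = y * T i) (h₀ : ∀ v, jucysComm T y 0 (X 0 (X 1 v)) = 0)
    (hk : ∀ n v, IsFixed T n v → jucys T y n v = 0) {n : ℕ} {v : V}
    (hv : IsFixed T (n + 2) v) : jucysComm T y n v = 0 := by
  have key : ∀ a, IsFixed T (n + 1) a → jucysComm T y n a = 0 := fun a ha => by
    rw [jucysComm, LinearMap.sub_apply, Module.End.mul_apply, Module.End.mul_apply, hk _ _ ha,
      hk (n + 1) _ (ha.apply fun i hi => h.hecke.T_jucys_of_lt hy hi), map_zero, sub_zero]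
  have hinv : ∀ w, jucysComm T y n w = 0 → jucysComm T y n (heckeInv T n w) = 0 := fun w hw => by
    rw [← Module.End.mul_apply, h.hecke.jucysComm_mul_inv, LinearMap.neg_apply,
      LinearMap.smul_apply, Module.End.mul_apply, hw, map_zero, smul_zero, neg_zero]
  obtain ⟨a, b, ha, hb, rfl⟩ := h.exists_eq_add hv
  obtain ⟨c, d, hc, -, hcd⟩ := h.exists_eq_add (hb.heckeInv h.hecke le_rfl : IsFixed T (n + 2) _)
  have hX : X (n + 1) b = t • heckeInv T n (X n (heckeInv T n b)) := by
    have e := LinearMap.congr_fun (h.T_X_T n) (heckeInv T n b)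
    simp only [Module.End.mul_apply, LinearMap.smul_apply, h.hecke.apply_inv] at e
    rw [← map_smul, ← e, ← Module.End.mul_apply, h.hecke.inv_mul, Module.End.one_apply]
  rw [map_add, key a ha, zero_add, hX, map_smul, hinv, smul_zero]
  rw [hcd, map_add, map_add, h.jucysComm_X_X hy h₀, add_zero]
  exact key _ (hc.apply fun i hi => h.T_X (by omega) (by omega))

theorem IsAlmostSymmetric.jucysComm_zero (h : IsAlmostSymmetric T X)
    (hy : ∀ i, 0 < i → T i * y = y * T i) (h₀ : ∀ v, jucysComm T y 0 (X 0 (X 1 v)) = 0)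
    (hk : ∀ n v, IsFixed T n v → jucys T y n v = 0) : jucysComm T y 0 = 0 := by
  ext v
  obtain ⟨n, hv⟩ := h.exists_isFixed v
  -- Descending induction on the index of the commutator, from `n` to `0`, with the level `n + 2`
  -- held fixed: the inverses `T_m⁻¹ T_{m+1}⁻¹` used on the way preserve it.
  have key : ∀ d m, m + d = n → ∀ w, IsFixed T (n + 2) w → jucysComm T y m w = 0 := by
    intro d
    induction d with
    | zero =>
      rintro m rfl w hw
      exact h.jucysComm_of_isFixed hy h₀ hk hw
    | succ d ih =>
      intro m hm w hw
      have h₁ := ih (m + 1) (by omega) _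
        ((hw.heckeInv h.hecke (i := m + 1) (by omega)).heckeInv h.hecke (i := m) (by omega))
      rw [h.hecke.jucysComm_succ hy] at h₁
      simp only [LinearMap.smul_apply, Module.End.mul_apply, h.hecke.apply_inv] at h₁
      have ht : t⁻¹ * t⁻¹ ≠ 0 := mul_ne_zero (inv_ne_zero t_ne_zero) (inv_ne_zero t_ne_zero)
      exact h.hecke.eq_zero_of_apply
        (h.hecke.eq_zero_of_apply ((smul_eq_zero.1 h₁).resolve_left ht))
  exact key n 0 (zero_add n) v (hv.mono (by omega))

theorem IsAlmostSymmetric.exists_upProd_X (h : IsAlmostSymmetric T X) (n : ℕ) (b : V) :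
    ∃ c, upProd T n (X n b) = X 0 c := by
  induction n generalizing b with
  | zero => exact ⟨b, rfl⟩
  | succ n ih =>
    obtain ⟨c, hc⟩ := ih (t • heckeInv T n b)
    refine ⟨c, ?_⟩
    rw [← hc, upProd, Module.End.mul_apply]
    congr 1
    have e := LinearMap.congr_fun (h.T_X_T n) (heckeInv T n b)
    simp only [Module.End.mul_apply, LinearMap.smul_apply, h.hecke.apply_inv] at e
    rw [e, map_smul]

/-- Apply `T_{n-1}⁻¹ ⋯ T_0⁻¹` to `v`, split off `X n b` from the result, and go back: `T_0 ⋯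
T_{n-1}` turns `X n b` into a multiple of `X 0`. -/
theorem IsAlmostSymmetric.exists_eq_upProd_add (h : IsAlmostSymmetric T X) {n : ℕ} {v : V}
    (hv : IsFixed T n v) : ∃ a c, IsFixed T n a ∧ v = upProd T n a + X 0 c := by
  have key : ∀ m, m ≤ n → ∃ w, IsFixed T (n + 1) w ∧ v = upProd T m w := by
    intro m
    induction m with
    | zero => exact fun _ => ⟨v, hv.mono (by omega), rfl⟩
    | succ m ih =>
      intro hm
      obtain ⟨w, hw, rfl⟩ := ih (by omega)
      refine ⟨heckeInv T m w, hw.heckeInv h.hecke (by omega), ?_⟩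
      rw [upProd, Module.End.mul_apply, h.hecke.apply_inv]
  obtain ⟨w, hw, rfl⟩ := key n le_rfl
  obtain ⟨a, b, ha, -, rfl⟩ := h.exists_eq_add hw
  obtain ⟨c, hc⟩ := h.exists_upProd_X n b
  exact ⟨a, c, ha, by rw [map_add, hc]⟩

end Module

/-- The additive group underlying the given module structure, in the form that makes the ring
structure of `Module.End K (PAs L)` available. -/
instance instAddCommGroupPAs : AddCommGroup (PAs L) := Module.addCommMonoidToAddCommGroup K

theorem isFixed_opT_iff (hL : IsDegreeClosed L) {n : ℕ} {F : PAs L} :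
    IsFixed (opT hL) n F ↔ (F : ℕ → R) ∈ PSym L n :=
  ⟨fun h => ⟨F.2.choose_spec.1, fun i hi => congrArg Subtype.val (h i hi)⟩,
    fun h i hi => Subtype.ext (h.2 i hi)⟩

theorem isAlmostSymmetric_op (hL : IsDegreeClosed L) :
    IsAlmostSymmetric (opT hL) (opX hL) where
  hecke := ⟨opT_comm hL, opT_braid hL, opT_mul_self hL⟩
  T_X_T := opT_opX_opT hL
  T_X := opT_opX hL
  exists_isFixed F := by
    obtain ⟨n, hn⟩ := F.2
    exact ⟨n, (isFixed_opT_iff hL).2 hn⟩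
  exists_eq_add {n F} hF := by
    obtain ⟨A, hA, B, hB, h⟩ := exists_eq_add_limX hL ((isFixed_opT_iff hL).1 hF)
    exact ⟨⟨A, n, hA⟩, ⟨B, n + 1, hB⟩, (isFixed_opT_iff hL).2 hA, (isFixed_opT_iff hL).2 hB,
      Subtype.ext h⟩

/-! ### Properties of the convergence -/

namespace ConvergesTo

theorem congr {f g F : ℕ → R} (h : ConvergesTo L f F) (hfg : ∀ᶠ k in atTop, f k = g k) :
    ConvergesTo L g F := by
  obtain ⟨N, h, u, a, b, hh, hu, hab, hf, rfl⟩ := h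
  refine ⟨N, h, u, a, b, hh, hu, hab, ?_, rfl⟩
  filter_upwards [hf, hfg] with k h₁ h₂
  rw [← h₂, h₁]

theorem of_eventually_eq {f F : ℕ → R} (hF : F ∈ L) (h : ∀ᶠ k in atTop, f k = F k) :
    ConvergesTo L f F :=
  ⟨0, F, Fin.elim0, Fin.elim0, Fin.elim0, hF, Fin.rec0, Fin.rec0, by simpa using h, by simp⟩

theorem of_eventually_eq_add_t_pow {f F E : ℕ → R} (hF : F ∈ L) (hE : E ∈ PAs L)
    (h : ∀ᶠ k in atTop, f k = F k + t ^ k • E k) : ConvergesTo L f F :=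
  ⟨1, F, fun _ => E, fun _ k => t ^ k, fun _ => 0, hF, fun _ => hE,
    fun _ => ScalarTendsTo.t_pow, by simpa using h, by simp⟩

theorem unique (hL : IsDegreeClosed L) {f F G : ℕ → R} (hF : F ∈ PInf) (hG : G ∈ PInf)
    (h₁ : ConvergesTo L f F) (h₂ : ConvergesTo L f G) : F = G :=
  PInf_ext_coeff hF hG fun m => (h₁.coeff hL m).unique (h₂.coeff hL m)

theorem eq_add (hL : IsDegreeClosed L) {f g h F G H : ℕ → R} (hF : F ∈ PInf) (hG : G ∈ PInf)
    (hH : H ∈ PInf) (h₀ : ConvergesTo L h H) (h₁ : ConvergesTo L f F) (h₂ : ConvergesTo L g G)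
    (e : ∀ k, h k = f k + g k) : H = F + G := by
  refine PInf_ext_coeff hH (add_mem hF hG) fun m => (h₀.coeff hL m).unique ?_
  rw [map_add]
  refine ((h₁.coeff hL m).add (h₂.coeff hL m)).congr (Eventually.of_forall fun k => ?_)
  rw [e, MvPolynomial.coeff_add]

theorem smul {f F : ℕ → R} (h : ConvergesTo L f F) (c : K) :
    ConvergesTo L (fun k => c • f k) (c • F) := by
  obtain ⟨N, h, u, a, b, hh, hu, hab, hf, rfl⟩ := h
  refine ⟨N, c • h, u, fun j k => c * a j k, fun j => c * b j, L.smul_mem c hh, hu,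
    fun j => (hab j).const_mul c, ?_, ?_⟩
  · filter_upwards [hf] with k hk
    rw [hk, smul_add, Finset.smul_sum]
    simp only [smul_smul, Pi.smul_apply]
  · rw [smul_add, Finset.smul_sum]
    simp only [smul_smul]

/-- Continuity of an operator on the inverse limit that is given by operators `φ` on
polynomials. -/
theorem map {f F : ℕ → R} (h : ConvergesTo L f F) (φ : R →ₗ[K] R)
    (Φ : (ℕ → R) →ₗ[K] (ℕ → R)) (hΦ : ∀ G ∈ L, Φ G ∈ L) (hΦ' : ∀ G ∈ PAs L, Φ G ∈ PAs L)
    (hφ : ∀ G ∈ L, ∀ᶠ k in atTop, Φ G k = φ (G k)) :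
    ConvergesTo L (fun k => φ (f k)) (Φ F) := by
  obtain ⟨N, h, u, a, b, hh, hu, hab, hf, rfl⟩ := h
  refine ⟨N, Φ h, fun j => Φ (u j), a, b, hΦ h hh, fun j => hΦ' _ (hu j), hab, ?_, ?_⟩
  · have hu' : ∀ᶠ k in atTop, ∀ j, Φ (u j) k = φ (u j k) :=
      eventually_all.2 fun j => hφ _ (hu j).choose_spec.1
    filter_upwards [hf, hφ h hh, hu'] with k h₁ h₂ h₃
    rw [h₁, map_add, map_sum, h₂]
    simp only [map_smul, h₃]
  · rw [map_add, map_sum]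
    simp only [map_smul]

theorem limT (hL : IsDegreeClosed L) {f F : ℕ → R} (h : ConvergesTo L f F) (i : ℕ) :
    ConvergesTo L (fun k => T i (f k)) (limT i F) :=
  h.map (T i) (StableDAHA.limT i) (fun _ hG => hL.limT_mem hG i)
    (fun G hG => (opT hL i ⟨G, hG⟩).2) fun G hG => by
      filter_upwards [eventually_ge_atTop (i + 2)] with k hk
      rw [limT_apply (hL.le hG) hk]

theorem limX (hL : IsDegreeClosed L) {f F : ℕ → R} (h : ConvergesTo L f F) (i : ℕ) :
    ConvergesTo L (fun k => x i * f k) (limX i F) :=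
  h.map (LinearMap.mulLeft K (x i)) (StableDAHA.limX i) (fun _ hG => hL.limX_mem hG i)
    (fun G hG => (opX hL i ⟨G, hG⟩).2) fun G _ => by
      filter_upwards [eventually_gt_atTop i] with k hk
      rw [limX_apply _ hk, LinearMap.mulLeft_apply]

end ConvergesTo

/-! ### The limit Cherednik operators -/

theorem upProd_opT_apply (hL : IsDegreeClosed L) {n k : ℕ} (h : n < k) (F : PAs L) :
    (upProd (opT hL) n F : ℕ → R) k = TUp n ((F : ℕ → R) k) := by
  induction n generalizing F with
  | zero => rfl
  | succ n ih =>
    rw [upProd, Module.End.mul_apply, ih (by omega), opT_apply hL (by omega)]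
    rfl

theorem exists_Ytilde_zero_upProd (hL : IsDegreeClosed L) {n : ℕ} {F : PAs L}
    (hF : IsFixed (opT hL) n F) :
    ∃ E ∈ PAs L, ∀ᶠ k in atTop, Ytilde k 0 ((upProd (opT hL) n F : ℕ → R) k) = t ^ k • E k := by
  have hF' := (isFixed_opT_iff hL).1 hF
  obtain ⟨E, hE, h⟩ := exists_varpi_eq hL hF'
  refine ⟨E, ⟨_, hE⟩, ?_⟩
  filter_upwards [eventually_gt_atTop n] with k hk
  rw [upProd_opT_apply hL hk, Ytilde_zero_apply, TinvChain_TUp (by omega), h k hk]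
  intro i h₁ h₂
  rw [T_eq_self_iff, (hL.mem_PSym_iff.1 hF').2 i k h₁ (by omega)]

theorem exists_convergesTo (hL : IsDegreeClosed L) (F : PAs L) :
    ∃ G : PAs L, ConvergesTo L (fun k => Ytilde k 0 ((F : ℕ → R) k)) (G : ℕ → R) := by
  obtain ⟨n, hn⟩ := (isAlmostSymmetric_op hL).exists_isFixed F
  obtain ⟨A, C, hA, rfl⟩ := (isAlmostSymmetric_op hL).exists_eq_upProd_add hn
  obtain ⟨E, hE, hE'⟩ := exists_Ytilde_zero_upProd hL hA
  obtain ⟨H, hH, hH'⟩ := exists_Ytilde_zero_limX hL (G := C) C.2.choose_spec.1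
  have hH'' : ∀ᶠ k in atTop, Ytilde k 0 ((opX hL 0 C : ℕ → R) k) = H k := by
    filter_upwards [eventually_gt_atTop 0] with k hk
    exact hH' k hk
  obtain ⟨m, hm⟩ := (opX hL 0 C).2
  -- The level is raised to `m + 1` to be positive, since `Ytilde k 0` commutes with `T_i` only for
  -- `i ≥ 1`.
  have hHm := mem_PSym_of_Ytilde_zero_eq hL (PSym_mono (Nat.le_succ m) hm) hH (by omega) hH''
  refine ⟨⟨H, _, hHm⟩, ConvergesTo.of_eventually_eq_add_t_pow hH hE ?_⟩
  filter_upwards [hE', hH''] with k h₁ h₂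
  rw [Submodule.coe_add, Pi.add_apply, map_add, h₁, h₂, add_comm]

/-- `𝒴_0` on the almost symmetric module. -/
def opYZero (hL : IsDegreeClosed L) : Module.End K (PAs L) where
  toFun F := (exists_convergesTo hL F).choose
  map_add' F G := Subtype.ext <| (exists_convergesTo hL (F + G)).choose_spec.eq_add hL
    (PAs_le_PInf hL _) (PAs_le_PInf hL _) (PAs_le_PInf hL _)
    (exists_convergesTo hL F).choose_spec (exists_convergesTo hL G).choose_spec
    fun k => map_add (Ytilde k 0) ((F : ℕ → R) k) ((G : ℕ → R) k)
  map_smul' c F := Subtype.ext <| (exists_convergesTo hL (c • F)).choose_spec.unique hL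
    (PAs_le_PInf hL _) (PAs_le_PInf hL (c • (exists_convergesTo hL F).choose)) <|
    ((exists_convergesTo hL F).choose_spec.smul c).congr <|
      Eventually.of_forall fun k => (map_smul (Ytilde k 0) c ((F : ℕ → R) k)).symm

theorem opYZero_spec (hL : IsDegreeClosed L) (F : PAs L) :
    ConvergesTo L (fun k => Ytilde k 0 ((F : ℕ → R) k)) (opYZero hL F : ℕ → R) :=
  (exists_convergesTo hL F).choose_spec

theorem opYZero_eq (hL : IsDegreeClosed L) {F G : PAs L}
    (h : ConvergesTo L (fun k => Ytilde k 0 ((F : ℕ → R) k)) (G : ℕ → R)) : opYZero hL F = G :=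
  Subtype.ext ((opYZero_spec hL F).unique hL (PAs_le_PInf hL _) (PAs_le_PInf hL _) h)

theorem opT_opYZero (hL : IsDegreeClosed L) {i : ℕ} (hi : 0 < i) :
    opT hL i * opYZero hL = opYZero hL * opT hL i := by
  refine LinearMap.ext fun F => ?_
  rw [Module.End.mul_apply, Module.End.mul_apply]
  symm
  apply opYZero_eq hL
  rw [coe_opT]
  refine ((opYZero_spec hL F).limT hL i).congr ?_
  filter_upwards [eventually_ge_atTop (i + 2)] with k hk
  rw [limT_apply (PAs_le_PInf hL F) hk, Ytilde_zero_T hi (by omega)]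

theorem opYZero_T_X (hL : IsDegreeClosed L) :
    opYZero hL * opT hL 0 * opX hL 0 = opX hL 1 * opYZero hL * opT hL 0 := by
  refine LinearMap.ext fun F => ?_
  simp only [Module.End.mul_apply]
  apply opYZero_eq hL
  rw [coe_opX]
  refine ((opYZero_spec hL (opT hL 0 F)).limX hL 1).congr ?_
  filter_upwards [eventually_ge_atTop 2] with k hk
  obtain ⟨m, rfl⟩ : ∃ m, k = m + 2 := ⟨k - 2, by omega⟩
  rw [opT_apply hL hk, opT_apply hL hk, opX_apply hL (by omega), Ytilde_zero_T_zero_x]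

theorem opYZero_upProd (hL : IsDegreeClosed L) {n : ℕ} {F : PAs L}
    (hF : IsFixed (opT hL) n F) : opYZero hL (upProd (opT hL) n F) = 0 := by
  obtain ⟨E, hE, h⟩ := exists_Ytilde_zero_upProd hL hF
  refine opYZero_eq hL (G := 0)
    (ConvergesTo.of_eventually_eq_add_t_pow (F := 0) (zero_mem L) hE ?_)
  simpa using h

/-- On multiples of `x 0` the limit is attained at finite level, so identities between finite-level
operators can be iterated there; for compositions of general limits this is not available. -/
theorem opYZero_apply_of_dvd (hL : IsDegreeClosed L) {F : PAs L}
    (h : ∀ᶠ k in atTop, x 0 ∣ (F : ℕ → R) k) :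
    ∀ᶠ k in atTop, (opYZero hL F : ℕ → R) k = Ytilde k 0 ((F : ℕ → R) k) := by
  obtain ⟨B, hB, hFB⟩ := hL.exists_limX_eq F.2.choose_spec.1 h
  obtain ⟨H, hH, hH'⟩ := exists_Ytilde_zero_limX hL hB
  have hH'' : ∀ᶠ k in atTop, Ytilde k 0 ((F : ℕ → R) k) = H k := by
    filter_upwards [eventually_gt_atTop 0] with k hk
    rw [hFB, hH' k hk]
  have e := (opYZero_spec hL F).unique hL (PAs_le_PInf hL _) (hL.le hH)
    (ConvergesTo.of_eventually_eq hH hH'')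
  filter_upwards [hH''] with k hk
  rw [e, hk]

theorem jucysComm_opYZero_X_X (hL : IsDegreeClosed L) (F : PAs L) :
    jucysComm (opT hL) (opYZero hL) 0 (opX hL 0 (opX hL 1 F)) = 0 := by
  set G := opX hL 0 (opX hL 1 F) with hG
  have hT : ∀ {u : PAs L}, (∀ᶠ k in atTop, x 0 * x 1 ∣ (u : ℕ → R) k) →
      ∀ᶠ k in atTop, x 0 * x 1 ∣ (opT hL 0 u : ℕ → R) k := fun {u} hu => by
    filter_upwards [hu, eventually_ge_atTop 2] with k h₁ h₂
    rw [opT_apply hL h₂]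
    exact dvd_T_zero h₁
  have hY : ∀ {u : PAs L}, (∀ᶠ k in atTop, x 0 * x 1 ∣ (u : ℕ → R) k) →
      ∀ᶠ k in atTop, (opYZero hL u : ℕ → R) k = Ytilde k 0 ((u : ℕ → R) k) := fun hu =>
    opYZero_apply_of_dvd hL (hu.mono fun k hk => (dvd_mul_right _ _).trans hk)
  have hYd : ∀ {u : PAs L}, (∀ᶠ k in atTop, x 0 * x 1 ∣ (u : ℕ → R) k) →
      ∀ᶠ k in atTop, x 0 * x 1 ∣ (opYZero hL u : ℕ → R) k := fun {u} hu => by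
    filter_upwards [hu, hY hu, eventually_ge_atTop 2] with k h₁ h₂ h₃
    obtain ⟨m, rfl⟩ : ∃ m, k = m + 2 := ⟨k - 2, by omega⟩
    rw [h₂]
    exact dvd_Ytilde_zero h₁
  have hGd : ∀ᶠ k in atTop, x 0 * x 1 ∣ (G : ℕ → R) k := by
    filter_upwards [eventually_ge_atTop 2] with k hk
    rw [hG, opX_apply hL (by omega), opX_apply hL (by omega), ← mul_assoc]
    exact dvd_mul_right _ _
  have key : opYZero hL (opT hL 0 (opYZero hL (opT hL 0 G))) =
      opT hL 0 (opYZero hL (opT hL 0 (opYZero hL G))) := by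
    refine PAs_ext hL ?_
    filter_upwards [hGd, hY hGd, hY (hT hGd), hY (hT (hYd hGd)), hY (hT (hYd (hT hGd))),
      eventually_ge_atTop 2] with k h₀ h₁ h₂ h₃ h₄ hk
    rw [h₄, opT_apply hL hk, h₂, opT_apply hL hk, opT_apply hL hk, h₃, opT_apply hL hk, h₁]
    obtain ⟨m, rfl⟩ : ∃ m, k = m + 2 := ⟨k - 2, by omega⟩
    exact Ytilde_zero_comm_of_dvd h₀
  rw [jucysComm, jucys_succ]
  simp only [jucys, LinearMap.sub_apply, Module.End.mul_apply, LinearMap.smul_apply, map_smul, key,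
    sub_self]

/-- `𝒴_i` on the almost symmetric module. -/
def opY (hL : IsDegreeClosed L) : ℕ → Module.End K (PAs L) := jucys (opT hL) (opYZero hL)

theorem opY_spec (hL : IsDegreeClosed L) (i : ℕ) (F : PAs L) :
    ConvergesTo L (fun k => Ytilde k i ((F : ℕ → R) k)) (opY hL i F : ℕ → R) := by
  induction i generalizing F with
  | zero => exact opYZero_spec hL F
  | succ i ih =>
    refine (((ih (opT hL i F)).limT hL i).smul t⁻¹).congr ?_
    filter_upwards [eventually_ge_atTop (i + 2)] with k hk
    rw [opT_apply hL hk, Ytilde_succ_apply]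

theorem opY_comm (hL : IsDegreeClosed L) (i j : ℕ) :
    opY hL i * opY hL j = opY hL j * opY hL i := by
  have hA := isAlmostSymmetric_op hL
  refine hA.hecke.jucys_comm (fun i hi => opT_opYZero hL hi) ?_ i j
  refine sub_eq_zero.1 (hA.jucysComm_zero (y := opYZero hL) (fun i hi => opT_opYZero hL hi)
    (jucysComm_opYZero_X_X hL) fun n F hF => ?_)
  -- Writing `y_n` as `d * y * (T_0 ⋯ T_{n-1})` shows that it kills vectors of level `n`, on which
  -- the deformed operator after `T_0 ⋯ T_{n-1}` is of size `t ^ k`.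
  obtain ⟨d, hd⟩ := exists_jucys_eq (opT hL) (opYZero hL) n
  rw [hd, Module.End.mul_apply, Module.End.mul_apply, opYZero_upProd hL hF, map_zero]

/-! ### The representation -/

/-- The action of the generators on the almost symmetric module. -/
def genAction (hL : IsDegreeClosed L) : Gen → Module.End K (PAs L)
  | Gen.T i => opT hL i
  | Gen.X i => opX hL i
  | Gen.Y i => opY hL i

theorem lift_fT (hL : IsDegreeClosed L) (i : ℕ) :
    FreeAlgebra.lift K (genAction hL) (fT i) = opT hL i := FreeAlgebra.lift_ι_apply _ _

theorem lift_fX (hL : IsDegreeClosed L) (i : ℕ) :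
    FreeAlgebra.lift K (genAction hL) (fX i) = opX hL i := FreeAlgebra.lift_ι_apply _ _

theorem lift_fY (hL : IsDegreeClosed L) (i : ℕ) :
    FreeAlgebra.lift K (genAction hL) (fY i) = opY hL i := FreeAlgebra.lift_ι_apply _ _

theorem lift_fTinv (hL : IsDegreeClosed L) (i : ℕ) :
    FreeAlgebra.lift K (genAction hL) (fTinv i) = heckeInv (opT hL) i := by
  rw [fTinv, map_smul, map_add, lift_fT, AlgHom.commutes, heckeInv,
    Algebra.algebraMap_eq_smul_one]

theorem quadratic_identity {F M : Type*} [Field F] [AddCommGroup M] [Module F M] (c : F)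
    (u v : M) : (1 - c) • u + c • v - u + c • (u - v) = 0 := by
  module

theorem lift_rel (hL : IsDegreeClosed L) {a b : Free} (h : Rel a b) :
    FreeAlgebra.lift K (genAction hL) a = FreeAlgebra.lift K (genAction hL) b := by
  have hA := isAlmostSymmetric_op hL
  have hy : ∀ i, 0 < i → opT hL i * opYZero hL = opYZero hL * opT hL i :=
    fun i hi => opT_opYZero hL hi
  induction h with
  | T_comm i j h => simp only [map_mul, lift_fT, opT_comm hL h]
  | braid i => simp only [map_mul, lift_fT, opT_braid hL i]
  | quadratic i =>
    simp only [map_mul, map_sub, map_add, map_one, map_zero, lift_fT, AlgHom.commutes]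
    rw [Algebra.algebraMap_eq_smul_one, mul_add, sub_mul, opT_mul_self, one_mul, mul_smul_comm,
      mul_one]
    exact quadratic_identity t _ _
  | X_succ i =>
    simp only [map_smul, map_mul, lift_fTinv, lift_fX]
    rw [← smul_mul_assoc, ← mul_smul_comm, ← opT_opX_opT, mul_assoc (heckeInv _ i), mul_assoc,
      mul_assoc (opT hL i), hA.hecke.mul_inv, mul_one, ← mul_assoc, hA.hecke.inv_mul, one_mul]
  | T_X i j h₁ h₂ => simp only [map_mul, lift_fT, lift_fX, opT_opX hL h₁ h₂]
  | X_comm i j => simp only [map_mul, lift_fX, opX_comm hL i j]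
  | Y_succ i =>
    simp only [map_smul, map_mul, lift_fT, lift_fY]
    rfl
  | T_Y i j h₁ h₂ =>
    simp only [map_mul, lift_fT, lift_fY]
    exact hA.hecke.T_jucys hy h₁ h₂
  | Y_comm i j => simp only [map_mul, lift_fY, opY_comm hL i j]
  | cross =>
    simp only [map_mul, lift_fT, lift_fX, lift_fY]
    exact opYZero_T_X hL

/-- The representation of `ℋ⁺` on the almost symmetric module by the limit operators. -/
def limRep (hL : IsDegreeClosed L) : HPlus →ₐ[K] Module.End K (PAs L) :=
  RingQuot.liftAlgHom K ⟨FreeAlgebra.lift K (genAction hL), fun _ _ h => lift_rel hL h⟩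

theorem limRep_mk (hL : IsDegreeClosed L) (a : Free) :
    limRep hL (HPlus.mk a) = FreeAlgebra.lift K (genAction hL) a :=
  RingQuot.liftAlgHom_mkAlgHom_apply K _ _ a

theorem algHom_ext_gen {A : Type*} [Ring A] [Algebra K A] {ρ σ : HPlus →ₐ[K] A}
    (hT : ∀ i, ρ (HPlus.T i) = σ (HPlus.T i)) (hX : ∀ i, ρ (HPlus.X i) = σ (HPlus.X i))
    (hY : ∀ i, ρ (HPlus.Y i) = σ (HPlus.Y i)) : ρ = σ := by
  refine RingQuot.ringQuot_ext' K (s := Rel) ρ σ (FreeAlgebra.hom_ext (funext fun g => ?_))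
  cases g with
  | T i => exact hT i
  | X i => exact hX i
  | Y i => exact hY i

theorem existsUnique_actsByLimitOperators (hL : IsDegreeClosed L) :
    ∃! ρ : HPlus →ₐ[K] Module.End K (PAs L), ActsByLimitOperators L ρ := by
  have hT (i : ℕ) : limRep hL (HPlus.T i) = opT hL i := (limRep_mk hL _).trans (lift_fT hL i)
  have hX (i : ℕ) : limRep hL (HPlus.X i) = opX hL i := (limRep_mk hL _).trans (lift_fX hL i)
  have hY (i : ℕ) : limRep hL (HPlus.Y i) = opY hL i := (limRep_mk hL _).trans (lift_fY hL i)
  refine ⟨limRep hL, fun i F => ?_, fun ρ hρ => algHom_ext_gen (fun i => ?_) (fun i => ?_)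
    fun i => ?_⟩
  · rw [hT, hX, hY]
    exact ⟨rfl, rfl, opY_spec hL i F⟩
  · rw [hT]
    exact LinearMap.ext fun F => Subtype.ext (hρ i F).1
  · rw [hX]
    exact LinearMap.ext fun F => Subtype.ext (hρ i F).2.1
  · rw [hY]
    exact LinearMap.ext fun F => Subtype.ext ((hρ i F).2.2.unique hL (PAs_le_PInf hL _)
      (PAs_le_PInf hL _) (opY_spec hL i F))

end StableDAHA

end

/-- The limit operators `𝒯_i`, `𝒳_i`, `𝒴_i` define an `ℋ⁺`-module structure on the almost symmetric
module, both for the inverse limit of rings and for the inverse limit of graded rings. -/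
theorem mainTheorem1 :
    (∃! ρ : StableDAHA.HPlus →ₐ[StableDAHA.K]
        Module.End StableDAHA.K (StableDAHA.PAs StableDAHA.PInf),
      StableDAHA.ActsByLimitOperators StableDAHA.PInf ρ) ∧
    (∃! ρ : StableDAHA.HPlus →ₐ[StableDAHA.K]
        Module.End StableDAHA.K (StableDAHA.PAs StableDAHA.PInfGr),
      StableDAHA.ActsByLimitOperators StableDAHA.PInfGr ρ) :=
  ⟨StableDAHA.existsUnique_actsByLimitOperators StableDAHA.isDegreeClosed_PInf,
    StableDAHA.existsUnique_actsByLimitOperators StableDAHA.isDegreeClosed_PInfGr⟩
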